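/- **Conventions.** For $n\ge 1$ let $F_n$ be the free group with basis $x_0,\dots,x_{n-1}$, subscripts mod $n$, with shift automorphism $\theta(x_i)=x_{i+1}$. For $w\in F_n$ the cyclic presentation $P_n(w)$ is $\langle x_0,\dots,x_{n-1}\mid w,\theta(w),\dots,\theta^{n-1}(w)\rangle$ and $G_n(w)$ is the group it defines. $P_n(w)$ is *irreducible* if the greatest common divisor of $n$ and the subscripts of the generators that appear in $w$ is $1$. A presentation is *redundant* if it has a relator $r$ that is trivial in the free group, or is conjugate in the free group to $s$ or $s^{-1}$ for some relator $s\neq r$. The *star graph* of a presentation $\langle X\mid R\rangle$ is the graph (loops and multiple edges allowed) with vertex set $X\cup X^{-1}$ and an edge joining $x$ and $y$ for each distinct word $xy^{-1}u$ among the cyclic permutations of the elements of $R\cup R^{-1}$, where the edges given by $xy^{-1}u$ and by $yx^{-1}u^{-1}$ are identified. For $m\ge 2$, $k\ge 3$, $\nu\ge 1$ a finite presentation is *$(m,k,\nu)$-special* if its star graph has exactly $\nu$ components, these are pairwise isomorphic, each of them is a connected bipartite graph of diameter $m$ and girth $2m$ in which each vertex has degree at least $3$, every relator has length $k$, and $k\ge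 4$ if $m=2$. Elements of free groups are identified with reduced words, and $F_d$ denotes the free group of rank $d$. A group is *large* if some subgroup of finite index has a non-abelian free homomorphic image. **Statement.** (a) Let $n\ge1$ and $p,q,r\in\mathbb Z/n$, suppose that $P=P_n(x_0x_p^{-1}x_q^{-1}x_r)$ is irreducible and non-redundant, and let $G$ be the group defined by $P$. Then $P$ is $(2,4,\nu)$-special if and only if $n=4\nu$ and $(p,q,r)\equiv(\nu,-s,\nu-s)$ or $(3\nu,-s,3\nu-s)$ mod $n$ for some integer $s$ with $\gcd(s,\nu)=1$. In this case $G$ contains a subgroup isomorphic to $F_2\times F_2$, and $G$ admits an epimorphism onto the free group of rank $\nu$, and $G$ is large if $\nu>1$. Moreover, if $\nu=1$ then one of the following holds: (i) $G\cong G_4(x_0x_1^{-1}x_0^{-1}x_1)\cong F_2\times F_2$; (ii) $G\cong G_4(x_0x_1^{-2}x_2)$, which has $F_5\times F_5$ as a subgroup of index $16$; (iii) $G\cong G_4(x_0x_1^{-1}x_2^{-1}x_3)$, which has $F_3\times F_5$ as a subgroup of index $8$. (b) Let $n\ge1$ and $p,q,r\in\mathbb Z/n$, suppose that $P=P_n(x_0x_p^{-1}x_qx_r)$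 is irreducible, and let $G$ be the group defined by $P$. Then $P$ is $(2,4,\nu)$-special if and only if $\nu=1$, $n=4$ and one of the following holds: (i) $(p,q,r)\in\{(1,0,1),(3,0,3)\}$, in which case $G\cong G_4(x_0x_1^{-1}x_0x_1)$ and the derived subgroup $G'$ has index $16$ in $G$ and $G'\cong F_5\times F_5$; (ii) $(p,q,r)\in\{(1,0,3),(3,0,1)\}$, in which case $G\cong G_4(x_0x_1^{-1}x_0x_3)$ and $G$ has $F_5\times F_5$ as a subgroup of index $16$; (iii) $(p,q,r)\in\{(1,2,0),(3,2,0),(1,2,2),(3,2,2)\}$, in which case $G\cong G_4(x_0^2x_1^{-1}x_2)$. -/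

import Mathlib

open scoped Graph

namespace CyclicPresentation

/-! ### Multigraphs: paths, components, diameter, girth

Graphs may have loops and multiple edges; we use Mathlib's `Graph α β`, with vertices in `α` and
edges in `β`. -/

section Multigraph

variable {α β γ δ : Type*}

/-- `u 0, e 0, u 1, …, e (l - 1), u l` is a path of length `l` in `G`
(the values of `u` and `e` beyond `l` are irrelevant). -/
def IsPathOfLength (G : Graph α β) (l : ℕ) (u : ℕ → α) (e : ℕ → β) : Prop :=
  u 0 ∈ V(G) ∧ ∀ i < l, G.IsLink (e i) (u i) (u (i + 1))

/-- There is a path of length `l` from `x` to `y` in `G`. -/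
def JoinedBy (G : Graph α β) (l : ℕ) (x y : α) : Prop :=
  ∃ (u : ℕ → α) (e : ℕ → β), IsPathOfLength G l u e ∧ u 0 = x ∧ u l = y

/-- The distance between two vertices, `⊤` if there is no path between them. -/
noncomputable def distance (G : Graph α β) (x y : α) : ℕ∞ :=
  ⨅ (l : ℕ) (_ : JoinedBy G l x y), (l : ℕ∞)

/-- The diameter: the greatest distance between two vertices. -/
noncomputable def diameter (G : Graph α β) : ℕ∞ :=
  ⨆ (x ∈ V(G)) (y ∈ V(G)), distance G x y

/-- There is a reduced closed path of positive length `l`: consecutive edges are distinct. -/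
def HasReducedClosedPath (G : Graph α β) (l : ℕ) : Prop :=
  0 < l ∧ ∃ (u : ℕ → α) (e : ℕ → β), IsPathOfLength G l u e ∧ u l = u 0 ∧
    ∀ i, i + 1 < l → e i ≠ e (i + 1)

/-- The girth: the minimal length of a reduced closed path, `⊤` if there is none. -/
noncomputable def girth (G : Graph α β) : ℕ∞ :=
  ⨅ (l : ℕ) (_ : HasReducedClosedPath G l), (l : ℕ∞)

/-- A graph is connected if it has a vertex and any two vertices are joined by a path. -/
def IsConnectedGraph (G : Graph α β) : Prop :=
  V(G).Nonempty ∧ ∀ x ∈ V(G), ∀ y ∈ V(G), ∃ l, JoinedBy G l x y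

/-- `V(G)` is the disjoint union of two parts such that each edge joins one part to the other. -/
def IsBipartiteGraph (G : Graph α β) : Prop :=
  ∃ V₁ V₂ : Set α, V₁ ∪ V₂ = V(G) ∧ Disjoint V₁ V₂ ∧
    ∀ e x y, G.IsLink e x y → (x ∈ V₁ ∧ y ∈ V₂) ∨ (x ∈ V₂ ∧ y ∈ V₁)

/-- The degree of a vertex: the number of edge ends at it (so a loop counts twice). -/
noncomputable def degree (G : Graph α β) (x : α) : ℕ∞ :=
  {e | G.Inc e x}.encard + {e | G.IsLoopAt e x}.encard

/-- The connected components, as induced subgraphs on the classes of vertices joined by paths. -/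
def components (G : Graph α β) : Set (Graph α β) :=
  {K | ∃ x ∈ V(G), K = G.induce {y | ∃ l, JoinedBy G l x y}}

/-- Isomorphism of (unlabelled) multigraphs. -/
def AreIsomorphic (G : Graph α β) (H : Graph γ δ) : Prop :=
  ∃ (f : V(G) ≃ V(H)) (g : E(G) ≃ E(H)), ∀ (e : E(G)) (x y : V(G)),
    G.IsLink e x y ↔ H.IsLink (g e) (f x) (f y)

end Multigraph

/-! ### Star graphs and special presentations

A presentation with generating set `X` is given by its set `R` of relators in the free group on `X`.
The pair `(x, true)` stands for the letter `x` and `(x, false)` for `x⁻¹`. -/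

section Presentation

variable {X : Type*} [DecidableEq X]

/-- The inverse of a letter. -/
def invLetter (a : X × Bool) : X × Bool := (a.1, !a.2)

/-- The symmetrized closure: all cyclic permutations of the reduced words of elements
of `R ∪ R⁻¹`. -/
def symmetrizedClosure (R : Set (FreeGroup X)) : Set (List (X × Bool)) :=
  {W | ∃ r ∈ R, W ~r r.toWord ∨ W ~r (r⁻¹).toWord}

theorem inversePair_mem {R : Set (FreeGroup X)} {a b : X × Bool} {u : List (X × Bool)}
    (h : a :: invLetter b :: u ∈ symmetrizedClosure R) :
    b :: invLetter a :: FreeGroup.invRev u ∈ symmetrizedClosure R := by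
  have key : ∀ L : List (X × Bool), a :: invLetter b :: u ~r L →
      b :: invLetter a :: FreeGroup.invRev u ~r FreeGroup.invRev L := by
    intro L hL
    have h1 : FreeGroup.invRev (a :: invLetter b :: u) ~r FreeGroup.invRev L :=
      (hL.map _).reverse
    refine List.IsRotated.trans ?_ h1
    have h2 : FreeGroup.invRev (a :: invLetter b :: u) =
        FreeGroup.invRev u ++ [b, invLetter a] := by
      simp [FreeGroup.invRev, invLetter]
    rw [h2]
    exact List.isRotated_append (l := [b, invLetter a])
  obtain ⟨r, hr, h | h⟩ := h
  · exact ⟨r, hr, Or.inr (by rw [FreeGroup.toWord_inv]; exact key _ h)⟩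
  · refine ⟨r, hr, Or.inl ?_⟩
    have := key _ h
    rwa [FreeGroup.toWord_inv, FreeGroup.invRev_invRev] at this

/-- The star graph: its vertices are the letters; each word `x y⁻¹ u` in the symmetrized closure
gives an edge between `x` and `y`, and the edges given by the two words `x y⁻¹ u` and `y x⁻¹ u⁻¹`
of an inverse pair are identified, so that an edge is an unordered inverse pair of words. -/
def starGraph (R : Set (FreeGroup X)) : Graph (X × Bool) (Sym2 (List (X × Bool))) where
  vertexSet := Set.univ
  IsLink e x y := ∃ u, x :: invLetter y :: u ∈ symmetrizedClosure R ∧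
    e = s(x :: invLetter y :: u, y :: invLetter x :: FreeGroup.invRev u)
  isLink_symm := by
    rintro e -
    refine ⟨?_⟩
    rintro x y ⟨u, hu, rfl⟩
    refine ⟨FreeGroup.invRev u, inversePair_mem hu, ?_⟩
    rw [FreeGroup.invRev_invRev, Sym2.eq_swap]
  eq_or_eq_of_isLink_of_isLink := by
    rintro e x y v w ⟨u, -, rfl⟩ ⟨u', -, h⟩
    rcases Sym2.eq_iff.1 h with ⟨h, -⟩ | ⟨h, -⟩
    · exact Or.inl (List.cons.inj h).1
    · exact Or.inr (List.cons.inj h).1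
  left_mem_of_isLink := fun _ _ _ _ => Set.mem_univ _

/-- The finite presentation `⟨X | R⟩` is `(m, k, ν)`-special. -/
structure IsSpecial (m k ν : ℕ) (R : Set (FreeGroup X)) : Prop where
  finite_generators : Finite X
  finite_relators : R.Finite
  two_le : 2 ≤ m
  three_le : 3 ≤ k
  one_le : 1 ≤ ν
  card_components : (components (starGraph R)).encard = ν
  isomorphic_components : ∀ K ∈ components (starGraph R), ∀ K' ∈ components (starGraph R),
    AreIsomorphic K K'
  connected : ∀ K ∈ components (starGraph R), IsConnectedGraph K
  bipartite : ∀ K ∈ components (starGraph R), IsBipartiteGraph K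
  diameter_eq : ∀ K ∈ components (starGraph R), diameter K = m
  girth_eq : ∀ K ∈ components (starGraph R), girth K = 2 * m
  three_le_degree : ∀ K ∈ components (starGraph R), ∀ x ∈ V(K), 3 ≤ degree K x
  length_eq : ∀ r ∈ R, r.toWord.length = k
  four_le_of_eq_two : m = 2 → 4 ≤ k

/-- A presentation is redundant if some relator `r` is trivial in the free group, or is conjugate
there to `s` or `s⁻¹` for some relator `s` distinct from `r`. -/
def IsRedundant {X : Type*} (R : Set (FreeGroup X)) : Prop :=
  ∃ r ∈ R, r = 1 ∨ ∃ s ∈ R, r ≠ s ∧ (IsConj r s ∨ IsConj r s⁻¹)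

end Presentation

/-! ### Cyclic presentations

The generators `x_i` are indexed by `i : ZMod n`, that is, subscripts are taken modulo `n`. -/

section Cyclic

/-- The generator `x_i` of the free group `F_n`. -/
def x {n : ℕ} (i : ZMod n) : FreeGroup (ZMod n) := FreeGroup.of i

/-- The shift automorphism `x_i ↦ x_{i+1}` of `F_n`. -/
def shift (n : ℕ) : FreeGroup (ZMod n) ≃* FreeGroup (ZMod n) :=
  FreeGroup.freeGroupCongr (Equiv.addRight 1)

/-- The relators `w, θ(w), …, θⁿ⁻¹(w)` of the cyclic presentation `P_n(w)`. -/
def relators (n : ℕ) (w : FreeGroup (ZMod n)) : Set (FreeGroup (ZMod n)) :=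
  {r | ∃ i < n, r = (shift n)^[i] w}

/-- The cyclically presented group `G_n(w)`. -/
abbrev CyclicGroup (n : ℕ) (w : FreeGroup (ZMod n)) : Type :=
  PresentedGroup (relators n w)

/-- `P_n(w)` is irreducible: the greatest common divisor of `n` and the subscripts of the
generators that appear in (the reduced word) `w` is `1`. -/
def IsIrreduciblePresentation (n : ℕ) (w : FreeGroup (ZMod n)) : Prop :=
  (w.toWord.map fun a => a.1.val).foldr Nat.gcd n = 1

end Cyclic

/-! ### Properties of groups -/

section Groups

/-- `G` has a subgroup isomorphic to `H`. -/
def HasSubgroupIso (G H : Type*) [Group G] [Group H] : Prop :=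
  ∃ K : Subgroup G, Nonempty (K ≃* H)

/-- `G` has a subgroup of index `d` isomorphic to `H`, where `d` is positive. -/
def HasSubgroupIsoOfIndex (G H : Type*) [Group G] [Group H] (d : ℕ) : Prop :=
  ∃ K : Subgroup G, K.index = d ∧ Nonempty (K ≃* H)

/-- `G` is large: some subgroup of finite index maps onto a non-abelian free group. -/
def IsLarge (G : Type*) [Group G] : Prop :=
  ∃ K : Subgroup G, K.FiniteIndex ∧
    ∃ (ι : Type) (_ : Nontrivial ι) (f : K →* FreeGroup ι), Function.Surjective f

/-- The free group `F_d` of rank `d`. -/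
abbrev F (d : ℕ) : Type := FreeGroup (Fin d)

end Groups

end CyclicPresentation

open CyclicPresentation

/-!
Write the words as `x_0 x_p⁻¹ x_q^{±1} x_r`. The relators have length four, so the star graph has
four edges for each `i : ZMod n`, one for each corner of a relator, and these are explicit
(`isLink_starGraph_iff`). In a `(2, 4, ν)`-special presentation the ends of a path of length three
are adjacent, because a component is bipartite of diameter two, and there are no double edges,
because the girth is four. Applied to the paths `x_{-p}, x_0, x_p, x_{2p}` and similar ones, this
forces `p` to have additive order four in `ℤ/n`, and `r = p + q` for the first family and
`q = 2 r + 2 p ∈ {0, 2 p}` for the second. Conversely, under these conditions the letters can be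
labelled by elements of `ℤ/n` so that two of them are adjacent exactly when their labels differ by
`± p` (`IsOrderFourGraph`); the components are then complete bipartite graphs `K_{4,4}`, one for
each coset of `ℤ p`, so that `n = 4 ν`. This is `isSpecial_word_iff`, and irreducibility turns it
into the stated lists.

In the first family the relations `x_{q+i} x_{p+i} = x_{p+q+i} x_i` say that `x_i` and `x_{p+i}`
commute up to the shift by `q`. The pairs of elements `x_d⁻¹ x_{d+2p}`, `x_{d-q} x_{d-q+2p}⁻¹` for
`d = 0` and for `d = p` commute with each other. There are actions on `F_2 × ℤ/n` in which one of
the pairs acts on `F_2 × {0}` by left multiplications by the free generators and the other one acts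
there trivially, so that the pairs generate a direct product `F_2 × F_2` (`hasSubgroupIso_prod`).
Identifying `x_i` with `x_{i+ν}` gives the map onto `F_ν`.

For `n = 4` the subgroups of finite index all come from one principle: if `G` acts simply
transitively on the set underlying a group `Γ`, and left multiplications by the elements of a
subgroup `K` of `Γ` are among the permutations by which `G` acts, then the elements of `G` acting in
this way form a copy of `K` in `G`, of the same index (`nonempty_translationSubgroup_mulEquiv`,
`index_translationSubgroup`). Here `Γ` is `F_2 × F_2`. In the first family `x_i` acts as a left
multiplication followed by the shift by `q`, and simple transitivity follows by comparing the
extensions of the two groups by their shifts. In the second family the relators are squares in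
which even and odd subscripts alternate, so that `G` acts on a product of two trees: every element
is a product of a word in the odd generators and one in the even generators, by exchanging letters
(`exists_eq_pairHom_mul`), and each half acts on one copy of `F_2` by left multiplications and on
the other one by permutations of finite order. Finally `K` is a product of kernels of maps from
`F_2` to `ℤ/2`, `ℤ/4` or `(ℤ/2)²`, whose free bases are found by the Schreier process
(`SchreierData`).
-/

namespace CyclicPresentation

/-! ### Paths, girth and diameter in multigraphs -/

section Multigraph

variable {α β γ δ : Type*}

theorem joinedBy_zero_iff [Nonempty β] {G : Graph α β} {x y : α} :
    JoinedBy G 0 x y ↔ x ∈ V(G) ∧ x = y := by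
  constructor
  · rintro ⟨u, e, ⟨h, -⟩, rfl, rfl⟩
    exact ⟨h, rfl⟩
  · rintro ⟨h, rfl⟩
    exact ⟨fun _ => x, fun _ => Classical.arbitrary β, ⟨h, by simp⟩, rfl, rfl⟩

theorem joinedBy_succ_iff {G : Graph α β} {l : ℕ} {x z : α} :
    JoinedBy G (l + 1) x z ↔ ∃ y, JoinedBy G l x y ∧ G.Adj y z := by
  constructor
  · rintro ⟨u, e, ⟨h, h'⟩, rfl, rfl⟩
    exact ⟨u l, ⟨u, e, ⟨h, fun i hi => h' i (by omega)⟩, rfl, rfl⟩, e l, h' l (by omega)⟩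
  · rintro ⟨y, ⟨u, e, ⟨h, h'⟩, rfl, rfl⟩, e', he⟩
    refine ⟨fun i => if i ≤ l then u i else z, fun i => if i < l then e i else e', ⟨by simpa, ?_⟩,
      by simp, by simp⟩
    intro i hi
    rcases Nat.lt_succ_iff_lt_or_eq.1 hi with hi | rfl
    · simpa [hi, hi.le, Nat.succ_le_iff.2 hi] using h' i hi
    · simpa using he

theorem joinedBy_one_iff {G : Graph α β} {x y : α} : JoinedBy G 1 x y ↔ G.Adj x y := by
  constructor
  · rintro ⟨u, e, ⟨h, h'⟩, rfl, rfl⟩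
    exact ⟨e 0, h' 0 one_pos⟩
  · rintro ⟨e, he⟩
    have : Nonempty β := ⟨e⟩
    exact joinedBy_succ_iff.2 ⟨x, joinedBy_zero_iff.2 ⟨he.left_mem, rfl⟩, e, he⟩

theorem distance_le_iff {G : Graph α β} {x y : α} {d : ℕ} :
    distance G x y ≤ d ↔ ∃ l ≤ d, JoinedBy G l x y := by
  constructor
  · intro h
    by_contra! hc
    have : ((d + 1 : ℕ) : ℕ∞) ≤ distance G x y := by
      refine le_iInf₂ fun l hl => ?_
      by_contra! hlt
      exact hc l (by have : l < d + 1 := by exact_mod_cast hlt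
                     omega) hl
    have := this.trans h
    norm_cast at this
    omega
  · rintro ⟨l, hl, h⟩
    exact (iInf₂_le l h).trans (by exact_mod_cast hl)

theorem girth_le_of_hasReducedClosedPath {G : Graph α β} {l : ℕ} (h : HasReducedClosedPath G l) :
    girth G ≤ l :=
  iInf₂_le l h

/-- Between graphs without multiple edges, a vertex bijection that preserves and reflects adjacency
is an isomorphism. -/
theorem areIsomorphic_of_adj_iff {G : Graph α β} {H : Graph γ δ}
    (hG : ∀ e e' x y, G.IsLink e x y → G.IsLink e' x y → e = e')
    (hH : ∀ e e' x y, H.IsLink e x y → H.IsLink e' x y → e = e')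
    (f : V(G) ≃ V(H)) (hf : ∀ x y : V(G), G.Adj x y ↔ H.Adj (f x) (f y)) :
    AreIsomorphic G H := by
  have key : ∀ e : E(G), ∃ e' : E(H), ∀ x y : V(G), G.IsLink e x y ↔ H.IsLink e' (f x) (f y) := by
    rintro ⟨e, he⟩
    obtain ⟨x, y, h⟩ := G.exists_isLink_of_mem_edgeSet he
    obtain ⟨e', h'⟩ := (hf ⟨x, h.left_mem⟩ ⟨y, h.right_mem⟩).1 ⟨e, h⟩
    refine ⟨⟨e', h'.edge_mem⟩, fun u v => ?_⟩
    rw [h.isLink_iff, h'.isLink_iff]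
    simp [← Subtype.ext_iff, f.injective.eq_iff]
    simp [Subtype.ext_iff]
  have key' : ∀ e' : E(H), ∃ e : E(G), ∀ x y : V(H),
      H.IsLink e' x y ↔ G.IsLink e (f.symm x) (f.symm y) := by
    rintro ⟨e, he⟩
    obtain ⟨x, y, h⟩ := H.exists_isLink_of_mem_edgeSet he
    obtain ⟨e', h'⟩ := (hf (f.symm ⟨x, h.left_mem⟩) (f.symm ⟨y, h.right_mem⟩)).2 ⟨e, by simpa⟩
    refine ⟨⟨e', h'.edge_mem⟩, fun u v => ?_⟩
    rw [h.isLink_iff, h'.isLink_iff]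
    simp [← Subtype.ext_iff, f.symm.injective.eq_iff]
    simp [Subtype.ext_iff]
  choose g hg using key
  choose g' hg' using key'
  refine ⟨f, ⟨g, g', fun e => ?_, fun e => ?_⟩, hg⟩
  · obtain ⟨x, y, h⟩ := G.exists_isLink_of_mem_edgeSet e.2
    have h1 := (hg e ⟨x, h.left_mem⟩ ⟨y, h.right_mem⟩).1 h
    have h2 := (hg' _ _ _).1 h1
    simp only [Equiv.symm_apply_apply] at h2
    exact Subtype.ext (hG _ _ _ _ h2 h)
  · obtain ⟨x, y, h⟩ := H.exists_isLink_of_mem_edgeSet e.2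
    have h1 := (hg' e ⟨x, h.left_mem⟩ ⟨y, h.right_mem⟩).1 h
    have h2 := (hg _ _ _).1 h1
    simp only [Equiv.apply_symm_apply] at h2
    exact Subtype.ext (hH _ _ _ _ h2 h)

theorem adj_induce_iff {G : Graph α β} {S : Set α} {x y : α} :
    (G.induce S).Adj x y ↔ G.Adj x y ∧ x ∈ S ∧ y ∈ S := by
  simp only [Graph.Adj, Graph.induce_isLink]
  tauto

/-- In a connected bipartite graph of diameter two the ends of a path of length three are
adjacent. -/
theorem adj_of_path_three {K : Graph α β} (hb : IsBipartiteGraph K) (hd : diameter K = (2 : ℕ))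
    {x y z t : α} (hxy : K.Adj x y) (hyz : K.Adj y z) (hzt : K.Adj z t) : K.Adj x t := by
  obtain ⟨e₁, h₁⟩ := hxy
  have : Nonempty β := ⟨e₁⟩
  obtain ⟨e₂, h₂⟩ := hyz
  obtain ⟨e₃, h₃⟩ := hzt
  have hle : distance K x t ≤ (2 : ℕ) := by
    rw [← hd]
    exact le_iSup₂_of_le x h₁.left_mem (le_iSup₂_of_le t h₃.right_mem le_rfl)
  obtain ⟨V₁, V₂, -, hdis, hV⟩ := hb
  have hside : ∀ a b, K.Adj a b → (a ∈ V₁ ∧ b ∉ V₁ ∨ a ∉ V₁ ∧ b ∈ V₁) := by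
    rintro a b ⟨e, h⟩
    have := Set.disjoint_left.1 hdis
    rcases hV e a b h with ⟨h1, h2⟩ | ⟨h1, h2⟩
    · exact Or.inl ⟨h1, fun h => this h h2⟩
    · exact Or.inr ⟨fun h => this h h1, h2⟩
  obtain ⟨l, hl, hj⟩ := distance_le_iff.1 hle
  have s₁ := hside x y ⟨_, h₁⟩
  have s₂ := hside y z ⟨_, h₂⟩
  have s₃ := hside z t ⟨_, h₃⟩
  interval_cases l
  · obtain ⟨-, rfl⟩ := joinedBy_zero_iff.1 hj
    tauto
  · exact joinedBy_one_iff.1 hj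
  · obtain ⟨a, ha, hat⟩ := joinedBy_succ_iff.1 hj
    have s₄ := hside x a (joinedBy_one_iff.1 ha)
    have s₅ := hside a t hat
    tauto

/-- A graph of girth four has no double edges. -/
theorem edge_unique_of_girth {K : Graph α β} (hg : girth K = 2 * (2 : ℕ)) {e e' : β} {x y : α}
    (h : K.IsLink e x y) (h' : K.IsLink e' x y) : e = e' := by
  by_contra hne
  have : girth K ≤ (2 : ℕ) := by
    refine girth_le_of_hasReducedClosedPath ⟨two_pos, fun i => if i = 1 then y else x,
      fun i => if i = 0 then e else e', ⟨by simpa using h.left_mem, ?_⟩, by simp, ?_⟩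
    · intro i hi
      interval_cases i
      · simpa using h
      · simpa using h'.symm
    · intro i hi
      have : i = 0 := by omega
      subst this
      simpa using hne
  rw [hg] at this
  norm_num at this

end Multigraph

/-! ### Graphs with complete bipartite components indexed by cosets -/

section ClosedUnderJoining

variable {α β : Type*}

theorem mem_component_of_adj {G : Graph α β} {x y z : α} (hy : ∃ l, JoinedBy G l x y)
    (h : G.Adj y z) : ∃ l, JoinedBy G l x z := by
  obtain ⟨l, hl⟩ := hy
  exact ⟨l + 1, joinedBy_succ_iff.2 ⟨y, hl, h⟩⟩

theorem IsSpecial.adj_of_path_three {X : Type*} [DecidableEq X] {k ν : ℕ} {R : Set (FreeGroup X)}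
    (h : IsSpecial 2 k ν R) {x y z t : X × Bool} (hxy : (starGraph R).Adj x y)
    (hyz : (starGraph R).Adj y z) (hzt : (starGraph R).Adj z t) : (starGraph R).Adj x t := by
  obtain ⟨e, he⟩ := id hxy
  have hK : (starGraph R).induce {v | ∃ l, JoinedBy (starGraph R) l x v} ∈
      components (starGraph R) := ⟨x, he.left_mem, rfl⟩
  have mx : ∃ l, JoinedBy (starGraph R) l x x := ⟨0, joinedBy_zero_iff.2 ⟨he.left_mem, rfl⟩⟩
  have my := mem_component_of_adj mx hxy
  have mz := mem_component_of_adj my hyz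
  have mt := mem_component_of_adj mz hzt
  exact (adj_induce_iff.1 (CyclicPresentation.adj_of_path_three (h.bipartite _ hK)
    (h.diameter_eq _ hK) (adj_induce_iff.2 ⟨hxy, mx, my⟩) (adj_induce_iff.2 ⟨hyz, my, mz⟩)
    (adj_induce_iff.2 ⟨hzt, mz, mt⟩))).1

theorem IsSpecial.edge_unique {X : Type*} [DecidableEq X] {k ν : ℕ} {R : Set (FreeGroup X)}
    (h : IsSpecial 2 k ν R) {e e' : Sym2 (List (X × Bool))} {x y : X × Bool}
    (he : (starGraph R).IsLink e x y) (he' : (starGraph R).IsLink e' x y) : e = e' := by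
  have hK : (starGraph R).induce {v | ∃ l, JoinedBy (starGraph R) l x v} ∈
      components (starGraph R) := ⟨x, he.left_mem, rfl⟩
  have mx : ∃ l, JoinedBy (starGraph R) l x x := ⟨0, joinedBy_zero_iff.2 ⟨he.left_mem, rfl⟩⟩
  have my := mem_component_of_adj mx ⟨e, he⟩
  exact edge_unique_of_girth (h.girth_eq _ hK) ⟨he, mx, my⟩ ⟨he', mx, my⟩

end ClosedUnderJoining

/-- A graph whose vertices are labelled by elements of a ring `A` such that two vertices are
adjacent exactly when their labels differ by `± p`, where `p` has additive order four. Its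
components are then complete bipartite graphs, one for each coset of `ℤ p`, with the labels
`a, a + 2p` on one side and `a ± p` on the other. -/
structure IsOrderFourGraph {α β A : Type*} [CommRing A] (G : Graph α β) (φ : α → A) (p : A) :
    Prop where
  four : 4 * p = 0
  two : 2 * p ≠ 0
  mem : ∀ x, x ∈ V(G)
  unique : ∀ e e' x y, G.IsLink e x y → G.IsLink e' x y → e = e'
  adj : ∀ x y, G.Adj x y ↔ φ y = φ x + p ∨ φ y = φ x - p
  fiber : ∀ a, ∃ x y, x ≠ y ∧ φ x = a ∧ φ y = a
  translate : ∀ t, ∃ f : α ≃ α, ∀ x, φ (f x) = φ x + t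

namespace IsOrderFourGraph

variable {α β A : Type*} [CommRing A] {G : Graph α β} {φ : α → A} {p : A}

/-- The component of the vertices with label in `a + ℤ p`. -/
def comp (G : Graph α β) (φ : α → A) (p a : A) : Graph α β :=
  G.induce {y | φ y - a ∈ AddSubgroup.zmultiples p}

theorem mem_zmultiples_iff (h : IsOrderFourGraph G φ p) {a : A} :
    a ∈ AddSubgroup.zmultiples p ↔ a = 0 ∨ a = p ∨ a = 2 * p ∨ a = -p := by
  have h4 := h.four
  constructor
  · rintro ⟨k, rfl⟩
    have hk : k = 4 * (k / 4) + k % 4 := (Int.mul_ediv_add_emod k 4).symm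
    have : k • p = (k % 4) • p := by
      conv_lhs => rw [hk, add_smul, mul_comm, mul_smul]
      have : (4 : ℤ) • p = 0 := by simpa using h4
      rw [this]
      simp
    simp only [this]
    have h0 := Int.emod_nonneg k (by norm_num : (4 : ℤ) ≠ 0)
    have h1 := Int.emod_lt_of_pos k (by norm_num : (0 : ℤ) < 4)
    generalize k % 4 = j at h0 h1
    interval_cases j
    · simp
    · simp
    · simp
    · right; right; right
      simp only [zsmul_eq_mul]
      push_cast
      linear_combination h4
  · have hp := AddSubgroup.mem_zmultiples p
    rintro (rfl | rfl | rfl | rfl)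
    · exact zero_mem _
    · exact hp
    · simpa [two_mul] using add_mem hp hp
    · exact neg_mem hp

theorem p_ne_zero (h : IsOrderFourGraph G φ p) : p ≠ 0 := by
  rintro rfl
  exact h.two (by simp)

theorem three_mul_ne_zero (h : IsOrderFourGraph G φ p) : 3 * p ≠ 0 := fun h3 =>
  h.p_ne_zero (by linear_combination h.four - h3)

theorem nonempty_edge (h : IsOrderFourGraph G φ p) : Nonempty β := by
  obtain ⟨x, -, -, hx, -⟩ := h.fiber 0
  obtain ⟨y, -, -, hy, -⟩ := h.fiber p
  obtain ⟨e, -⟩ := (h.adj x y).2 (Or.inl (by rw [hx, hy]; ring))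
  exact ⟨e⟩

/-- Two vertices whose labels differ by an even multiple of `p` have a common neighbour. -/
theorem exists_common_neighbour (h : IsOrderFourGraph G φ p) {x y : α}
    (hxy : φ y = φ x ∨ φ y = φ x + 2 * p) :
    ∃ z, φ z = φ x + p ∧ G.Adj x z ∧ G.Adj z y := by
  obtain ⟨z, -, -, hz, -⟩ := h.fiber (φ x + p)
  refine ⟨z, hz, (h.adj _ _).2 (Or.inl hz), (h.adj _ _).2 ?_⟩
  rcases hxy with hxy | hxy
  · right; rw [hxy, hz]; ring
  · left; rw [hxy, hz]; ring

theorem mem_comp (h : IsOrderFourGraph G φ p) {a : A} {x : α} :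
    x ∈ V(comp G φ p a) ↔ φ x = a ∨ φ x = a + p ∨ φ x = a + 2 * p ∨ φ x = a - p := by
  change φ x - a ∈ AddSubgroup.zmultiples p ↔ _
  rw [h.mem_zmultiples_iff]
  grind

theorem adj_comp_iff {a : A} {x y : α} :
    (comp G φ p a).Adj x y ↔ G.Adj x y ∧ x ∈ V(comp G φ p a) ∧ y ∈ V(comp G φ p a) :=
  adj_induce_iff

theorem mem_comp_of_adj (h : IsOrderFourGraph G φ p) {a : A} {x y : α} (hxy : G.Adj x y)
    (hx : x ∈ V(comp G φ p a)) : y ∈ V(comp G φ p a) := by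
  have h4 := h.four
  rw [h.mem_comp] at hx ⊢
  rw [h.adj] at hxy
  grind

/-- Any two vertices of a component are joined by a path of length at most two. -/
theorem exists_joinedBy_comp (h : IsOrderFourGraph G φ p) {a : A} {x y : α}
    (hx : x ∈ V(comp G φ p a)) (hy : y ∈ V(comp G φ p a)) :
    ∃ l ≤ 2, JoinedBy (comp G φ p a) l x y := by
  have h4 := h.four
  have hd : φ y = φ x ∨ φ y = φ x + 2 * p ∨ (φ y = φ x + p ∨ φ y = φ x - p) := by
    rw [h.mem_comp] at hx hy
    grind
  rw [← or_assoc] at hd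
  rcases hd with hd | hd
  · obtain ⟨z, -, h1, h2⟩ := h.exists_common_neighbour hd
    have hz := h.mem_comp_of_adj h1 hx
    exact ⟨2, le_rfl, joinedBy_succ_iff.2 ⟨z, joinedBy_one_iff.2 (adj_comp_iff.2 ⟨h1, hx, hz⟩),
      adj_comp_iff.2 ⟨h2, hz, hy⟩⟩⟩
  · exact ⟨1, one_le_two, joinedBy_one_iff.2 (adj_comp_iff.2 ⟨(h.adj _ _).2 hd, hx, hy⟩)⟩

theorem joinedBy_mono {G H : Graph α β} (hV : V(G) ⊆ V(H))
    (hle : ∀ e x y, G.IsLink e x y → H.IsLink e x y) {l : ℕ} {x y : α} (h : JoinedBy G l x y) :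
    JoinedBy H l x y := by
  obtain ⟨u, e, ⟨h0, h1⟩, hx, hy⟩ := h
  exact ⟨u, e, ⟨hV h0, fun i hi => hle _ _ _ (h1 i hi)⟩, hx, hy⟩

theorem joined_iff (h : IsOrderFourGraph G φ p) {x y : α} :
    (∃ l, JoinedBy G l x y) ↔ y ∈ V(comp G φ p (φ x)) := by
  have := h.nonempty_edge
  have hx : x ∈ V(comp G φ p (φ x)) := h.mem_comp.2 (Or.inl rfl)
  constructor
  · rintro ⟨l, hl⟩
    induction l generalizing y with
    | zero => obtain ⟨-, rfl⟩ := joinedBy_zero_iff.1 hl; exact hx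
    | succ l ih =>
      obtain ⟨z, hz, hzy⟩ := joinedBy_succ_iff.1 hl
      exact h.mem_comp_of_adj hzy (ih hz)
  · intro hy
    obtain ⟨l, -, hl⟩ := h.exists_joinedBy_comp hx hy
    exact ⟨l, joinedBy_mono (G := comp G φ p (φ x)) (fun z _ => h.mem z)
      (fun e u v huv => huv.1) hl⟩

theorem components_eq (h : IsOrderFourGraph G φ p) :
    components G = Set.range (comp G φ p) := by
  ext K
  constructor
  · rintro ⟨x, -, rfl⟩
    exact ⟨φ x, congrArg G.induce (Set.ext fun y => h.joined_iff.symm)⟩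
  · rintro ⟨a, rfl⟩
    obtain ⟨x, -, -, rfl, -⟩ := h.fiber a
    exact ⟨x, h.mem x, congrArg G.induce (Set.ext fun y => h.joined_iff.symm)⟩

theorem comp_eq_comp_iff (h : IsOrderFourGraph G φ p) {a b : A} :
    comp G φ p a = comp G φ p b ↔ -a + b ∈ AddSubgroup.zmultiples p := by
  constructor
  · intro hab
    obtain ⟨x, -, -, hx, -⟩ := h.fiber b
    have hx' : x ∈ V(comp G φ p b) := h.mem_comp.2 (Or.inl hx)
    rw [← hab] at hx'
    change φ x - a ∈ AddSubgroup.zmultiples p at hx'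
    rwa [hx, sub_eq_neg_add] at hx'
  · intro hab
    refine congrArg G.induce (Set.ext fun y => ?_)
    change φ y - a ∈ AddSubgroup.zmultiples p ↔ φ y - b ∈ AddSubgroup.zmultiples p
    rw [show φ y - a = φ y - b + (-a + b) by ring]
    exact add_mem_cancel_right hab

theorem encard_components (h : IsOrderFourGraph G φ p) :
    (components G).encard = ENat.card (A ⧸ AddSubgroup.zmultiples p) := by
  rw [h.components_eq]
  let f : A ⧸ AddSubgroup.zmultiples p → Graph α β :=
    Quotient.lift (comp G φ p) fun a b hab =>
      h.comp_eq_comp_iff.2 (QuotientAddGroup.leftRel_apply.1 hab)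
  have hf : Function.Injective f := by
    rintro ⟨a⟩ ⟨b⟩ hab
    exact Quotient.sound (QuotientAddGroup.leftRel_apply.2 (h.comp_eq_comp_iff.1 hab))
  have hr : Set.range (comp G φ p) = Set.range f := by
    ext K
    constructor
    · rintro ⟨a, rfl⟩; exact ⟨Quotient.mk _ a, rfl⟩
    · rintro ⟨⟨a⟩, rfl⟩; exact ⟨a, rfl⟩
  rw [hr, ← Set.image_univ, hf.encard_image, Set.encard_univ]

theorem isConnectedGraph_comp (h : IsOrderFourGraph G φ p) (a : A) :
    IsConnectedGraph (comp G φ p a) := by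
  obtain ⟨x, -, -, hx, -⟩ := h.fiber a
  refine ⟨⟨x, h.mem_comp.2 (Or.inl hx)⟩, fun u hu v hv => ?_⟩
  obtain ⟨l, -, hl⟩ := h.exists_joinedBy_comp hu hv
  exact ⟨l, hl⟩

theorem isBipartiteGraph_comp (h : IsOrderFourGraph G φ p) (a : A) :
    IsBipartiteGraph (comp G φ p a) := by
  have h4 := h.four
  have h3 := h.three_mul_ne_zero
  refine ⟨{x | φ x = a ∨ φ x = a + 2 * p}, {x | φ x = a + p ∨ φ x = a - p}, ?_, ?_, ?_⟩
  · ext x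
    rw [h.mem_comp]
    simp only [Set.mem_union, Set.mem_ofPred_eq]
    tauto
  · rw [Set.disjoint_left]
    intro x hx hx'
    simp only [Set.mem_ofPred_eq] at hx hx'
    grind
  · intro e x y hxy
    have hadj := (h.adj x y).1 ⟨e, hxy.1⟩
    have hx := h.mem_comp.1 hxy.2.1
    simp only [Set.mem_ofPred_eq]
    grind

theorem diameter_comp (h : IsOrderFourGraph G φ p) (a : A) :
    diameter (comp G φ p a) = (2 : ℕ) := by
  have := h.nonempty_edge
  have h0 := h.p_ne_zero
  apply le_antisymm
  · exact iSup₂_le fun x hx => iSup₂_le fun y hy =>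
      distance_le_iff.2 (h.exists_joinedBy_comp hx hy)
  · -- Two vertices with the same label are distinct and not adjacent.
    obtain ⟨x, y, hne, hx, hy⟩ := h.fiber a
    refine le_iSup₂_of_le x (h.mem_comp.2 (Or.inl hx))
      (le_iSup₂_of_le y (h.mem_comp.2 (Or.inl hy)) (le_iInf₂ fun l hl => ?_))
    by_contra! hlt
    have hlt : l < 2 := by exact_mod_cast hlt
    interval_cases l
    · exact hne (joinedBy_zero_iff.1 hl).2
    · have := (h.adj _ _).1 (adj_comp_iff.1 (joinedBy_one_iff.1 hl)).1
      rw [hx, hy] at this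
      grind

theorem girth_comp (h : IsOrderFourGraph G φ p) (a : A) :
    girth (comp G φ p a) = 2 * (2 : ℕ) := by
  have h3 := h.three_mul_ne_zero
  apply le_antisymm
  · obtain ⟨x, x', hx, hxa, hxa'⟩ := h.fiber a
    obtain ⟨y, y', hy, hya, hya'⟩ := h.fiber (a + p)
    have hlink : ∀ u v, φ u = a → φ v = a + p → ∃ e, (comp G φ p a).IsLink e u v := by
      intro u v hu hv
      exact adj_comp_iff.2 ⟨(h.adj _ _).2 (Or.inl (by rw [hu, hv])), h.mem_comp.2 (by simp [hu]),
        h.mem_comp.2 (by simp [hv])⟩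
    obtain ⟨e₀, h₀⟩ := hlink x y hxa hya
    obtain ⟨e₁, h₁⟩ := hlink x' y hxa' hya
    obtain ⟨e₂, h₂⟩ := hlink x' y' hxa' hya'
    obtain ⟨e₃, h₃⟩ := hlink x y' hxa hya'
    have : girth (comp G φ p a) ≤ (4 : ℕ) := by
      refine girth_le_of_hasReducedClosedPath ⟨by norm_num,
        fun i => if i = 1 then y else if i = 2 then x' else if i = 3 then y' else x,
        fun i => if i = 0 then e₀ else if i = 1 then e₁ else if i = 2 then e₂ else e₃,
        ⟨by simpa using h₀.left_mem, ?_⟩, by simp, ?_⟩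
      · intro i hi
        interval_cases i
        · simpa using h₀
        · simpa using h₁.symm
        · simpa using h₂
        · simpa using h₃.symm
      · intro i hi
        have hi : i < 3 := by omega
        interval_cases i
        · rintro (rfl : e₀ = e₁)
          exact hx (h₀.left_unique h₁)
        · rintro (rfl : e₁ = e₂)
          exact hy (h₁.right_unique h₂)
        · rintro (rfl : e₂ = e₃)
          exact hx (h₃.left_unique h₂)
    refine this.trans (by norm_num)
  · have : ((4 : ℕ) : ℕ∞) ≤ girth (comp G φ p a) := by
      refine le_iInf₂ fun l hl => ?_
      obtain ⟨hl, u, e, ⟨-, hp⟩, hc, hne⟩ := hl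
      by_contra! hlt
      have hlt : l < 4 := by exact_mod_cast hlt
      have hstep : ∀ i < l, φ (u (i + 1)) = φ (u i) + p ∨ φ (u (i + 1)) = φ (u i) - p :=
        fun i hi => (h.adj _ _).1 ⟨_, (hp i hi).1⟩
      interval_cases l
      · have := hstep 0 (by omega)
        simp only [zero_add, hc] at this
        grind
      · have l₀ := hp 0 (by omega)
        have l₁ := hp 1 (by omega)
        simp only [zero_add, Nat.reduceAdd, hc] at l₀ l₁
        exact hne 0 (by omega) (h.unique _ _ _ _ l₀.1 l₁.symm.1)
      · have s₀ := hstep 0 (by omega)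
        have s₁ := hstep 1 (by omega)
        have s₂ := hstep 2 (by omega)
        simp only [zero_add, Nat.reduceAdd, hc] at s₀ s₁ s₂
        grind
    refine le_trans (by norm_num) this

theorem three_le_degree_comp (h : IsOrderFourGraph G φ p) (a : A) {x : α}
    (hx : x ∈ V(comp G φ p a)) : 3 ≤ degree (comp G φ p a) x := by
  have h2 := h.two
  obtain ⟨y, y', hy, hya, hya'⟩ := h.fiber (φ x + p)
  obtain ⟨z, -, -, hz, -⟩ := h.fiber (φ x - p)
  have hlink : ∀ v, φ v = φ x + p ∨ φ v = φ x - p → ∃ e, (comp G φ p a).IsLink e x v := by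
    intro v hv
    have hadj := (h.adj x v).2 hv
    exact adj_comp_iff.2 ⟨hadj, hx, h.mem_comp_of_adj hadj hx⟩
  obtain ⟨e₁, h₁⟩ := hlink y (Or.inl hya)
  obtain ⟨e₂, h₂⟩ := hlink y' (Or.inl hya')
  obtain ⟨e₃, h₃⟩ := hlink z (Or.inr hz)
  have h12 : e₁ ≠ e₂ := by
    rintro rfl
    exact hy (h₁.right_unique h₂)
  have hyz : y ≠ z := by
    rintro rfl
    grind
  have hyz' : y' ≠ z := by
    rintro rfl
    grind
  have h13 : e₁ ≠ e₃ := by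
    rintro rfl
    exact hyz (h₁.right_unique h₃)
  have h23 : e₂ ≠ e₃ := by
    rintro rfl
    exact hyz' (h₂.right_unique h₃)
  have hsub : ({e₁, e₂, e₃} : Set β) ⊆ {e | (comp G φ p a).Inc e x} := by
    rintro e (rfl | rfl | rfl)
    exacts [⟨_, h₁⟩, ⟨_, h₂⟩, ⟨_, h₃⟩]
  have hcard : ({e₁, e₂, e₃} : Set β).encard = 3 :=
    Set.encard_eq_three.2 ⟨_, _, _, h12, h13, h23, rfl⟩
  rw [← hcard]
  exact (Set.encard_le_encard hsub).trans le_self_add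

theorem areIsomorphic_comp (h : IsOrderFourGraph G φ p) (a b : A) :
    AreIsomorphic (comp G φ p a) (comp G φ p b) := by
  obtain ⟨f, hf⟩ := h.translate (b - a)
  have hu : ∀ c e e' x y, (comp G φ p c).IsLink e x y → (comp G φ p c).IsLink e' x y → e = e' :=
    fun c e e' x y he he' => h.unique _ _ _ _ he.1 he'.1
  have hfm : ∀ x, x ∈ V(comp G φ p a) ↔ f x ∈ V(comp G φ p b) := by
    intro x
    rw [h.mem_comp, h.mem_comp, hf]
    grind
  refine areIsomorphic_of_adj_iff (hu a) (hu b) (f.subtypeEquiv hfm) ?_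
  rintro ⟨x, hx⟩ ⟨y, hy⟩
  simp only [Equiv.subtypeEquiv_apply, adj_comp_iff, ← hfm, hx, hy, and_true, h.adj, hf]
  grind

end IsOrderFourGraph

/-- A presentation with relators of length four whose star graph is an order-four graph is
`(2, 4, ν)`-special, `ν` being the number of cosets of `ℤ p`. -/
theorem isSpecial_of_isOrderFourGraph {X A : Type*} [DecidableEq X] [Finite X] [CommRing A]
    [Finite A] {R : Set (FreeGroup X)} (hR : R.Finite) (hlen : ∀ r ∈ R, r.toWord.length = 4)
    {φ : X × Bool → A} {p : A} (h : IsOrderFourGraph (starGraph R) φ p) :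
    IsSpecial 2 4 (AddSubgroup.zmultiples p).index R where
  finite_generators := inferInstance
  finite_relators := hR
  two_le := le_rfl
  three_le := by norm_num
  one_le := Nat.one_le_iff_ne_zero.2 AddSubgroup.index_ne_zero_of_finite
  card_components := by
    rw [h.encard_components, ENat.card_eq_coe_natCard]
    rfl
  isomorphic_components := by
    rw [h.components_eq]
    rintro _ ⟨a, rfl⟩ _ ⟨b, rfl⟩
    exact h.areIsomorphic_comp a b
  connected := by
    rw [h.components_eq]
    rintro _ ⟨a, rfl⟩
    exact h.isConnectedGraph_comp a
  bipartite := by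
    rw [h.components_eq]
    rintro _ ⟨a, rfl⟩
    exact h.isBipartiteGraph_comp a
  diameter_eq := by
    rw [h.components_eq]
    rintro _ ⟨a, rfl⟩
    exact h.diameter_comp a
  girth_eq := by
    rw [h.components_eq]
    rintro _ ⟨a, rfl⟩
    exact h.girth_comp a
  three_le_degree := by
    rw [h.components_eq]
    rintro _ ⟨a, rfl⟩ x hx
    exact h.three_le_degree_comp a hx
  length_eq := hlen
  four_le_of_eq_two := fun _ => le_rfl

/-! ### Star graphs of cyclic presentations with relators of length four -/

theorem shift_iterate {n : ℕ} (i : ℕ) (w : FreeGroup (ZMod n)) :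
    (shift n)^[i] w = FreeGroup.map (· + (i : ZMod n)) w := by
  induction i with
  | zero => simp [FreeGroup.map.id']
  | succ i ih =>
    rw [Function.iterate_succ_apply', ih]
    change FreeGroup.map _ _ = _
    rw [FreeGroup.map.comp]
    congr 2
    funext j
    simp [add_assoc]

theorem mem_relators_iff {n : ℕ} [NeZero n] {w r : FreeGroup (ZMod n)} :
    r ∈ relators n w ↔ ∃ i : ZMod n, r = FreeGroup.map (· + i) w := by
  constructor
  · rintro ⟨i, -, rfl⟩
    exact ⟨i, shift_iterate i w⟩
  · rintro ⟨i, rfl⟩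
    exact ⟨i.val, ZMod.val_lt i, by rw [shift_iterate, ZMod.natCast_zmod_val]⟩

theorem finite_relators {n : ℕ} (w : FreeGroup (ZMod n)) : (relators n w).Finite :=
  ((Set.finite_Iio n).image fun i => (shift n)^[i] w).subset <| by
    rintro r ⟨i, hi, rfl⟩
    exact ⟨i, hi, rfl⟩

/-- The word `x_0 x_p⁻¹ x_q^{±1} x_r`, the sign being positive when `b` is `true`. -/
def word {n : ℕ} (b : Bool) (p q r : ZMod n) : FreeGroup (ZMod n) :=
  FreeGroup.mk [(0, true), (p, false), (q, b), (r, true)]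

/-- The letters of the `i`-th shift of `word b p q r`. -/
def letters {n : ℕ} (b : Bool) (p q r i : ZMod n) : List (ZMod n × Bool) :=
  [(i, true), (p + i, false), (q + i, b), (r + i, true)]

theorem word_false {n : ℕ} (p q r : ZMod n) :
    word false p q r = x 0 * (x p)⁻¹ * (x q)⁻¹ * x r := rfl

/-- The word `x_0 x_p⁻¹ x_q^{±1} x_r` is reduced. -/
def IsReducedWord {n : ℕ} (b : Bool) (p q r : ZMod n) : Prop :=
  p ≠ 0 ∧ (b = true → p ≠ q) ∧ (b = false → q ≠ r)

section

variable {n : ℕ} {b : Bool} {p q r : ZMod n}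

theorem toWord_map_word (h : IsReducedWord b p q r) (i : ZMod n) :
    (FreeGroup.map (· + i) (word b p q r)).toWord = letters b p q r i := by
  rw [word, FreeGroup.map.mk, FreeGroup.toWord_mk]
  simp only [List.map_cons, List.map_nil, zero_add]
  obtain ⟨h1, h2, h3⟩ := h
  refine FreeGroup.IsReduced.reduce_eq ?_
  simp only [FreeGroup.isReduced_cons_cons, FreeGroup.IsReduced.singleton]
  cases b <;> simp_all

theorem toWord_word (h : IsReducedWord b p q r) :
    (word b p q r).toWord = [(0, true), (p, false), (q, b), (r, true)] := by
  have := toWord_map_word h 0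
  simpa [letters, FreeGroup.map.id'] using this

theorem isReducedWord_of_length (h : (word b p q r).toWord.length = 4) :
    IsReducedWord b p q r := by
  by_contra hc
  have h2 : (word b p q r).norm ≤ 2 := by
    simp only [IsReducedWord, not_and_or, not_not, Classical.not_imp, ne_eq] at hc
    rcases hc with rfl | ⟨rfl, rfl⟩ | ⟨rfl, rfl⟩
    · have : word b 0 q r = FreeGroup.mk [(q, b), (r, true)] :=
        Quot.sound (FreeGroup.Red.Step.not (L₁ := []) (x := 0) (b := true))
      rw [this]
      exact FreeGroup.norm_mk_le
    · have : word true p p r = FreeGroup.mk [(0, true), (r, true)] :=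
        Quot.sound (FreeGroup.Red.Step.not (L₁ := [(0, true)]) (x := p) (b := false))
      rw [this]
      exact FreeGroup.norm_mk_le
    · have : word false p q q = FreeGroup.mk [(0, true), (p, false)] :=
        Quot.sound (FreeGroup.Red.Step.not (L₁ := [(0, true), (p, false)]) (x := q) (b := false))
      rw [this]
      exact FreeGroup.norm_mk_le
  rw [FreeGroup.norm, h] at h2
  omega

theorem isRotated_four_iff {α : Type*} {W : List α} {a b c d : α} :
    W ~r [a, b, c, d] ↔
      W = [a, b, c, d] ∨ W = [b, c, d, a] ∨ W = [c, d, a, b] ∨ W = [d, a, b, c] := by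
  rw [← List.mem_cyclicPermutations_iff]
  simp [List.cyclicPermutations_cons, List.tails, List.inits]

/-- The edge given by the word `a b c d` in the letters. -/
def wordEdge {X : Type*} (a b c d : X × Bool) : Sym2 (List (X × Bool)) :=
  s([a, b, c, d], [invLetter b, invLetter a, invLetter d, invLetter c])

/-- The edges of the star graph, one for each corner of each shift of the relator. -/
theorem isLink_starGraph_iff [NeZero n] (h : IsReducedWord b p q r)
    {e : Sym2 (List (ZMod n × Bool))} {u v : ZMod n × Bool} :
    (starGraph (relators n (word b p q r))).IsLink e u v ↔ ∃ i : ZMod n,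
      (e = wordEdge (i, true) (p + i, false) (q + i, b) (r + i, true) ∧
        s(u, v) = s((i, true), (p + i, true))) ∨
      (e = wordEdge (p + i, false) (q + i, b) (r + i, true) (i, true) ∧
        s(u, v) = s((p + i, false), (q + i, !b))) ∨
      (e = wordEdge (q + i, b) (r + i, true) (i, true) (p + i, false) ∧
        s(u, v) = s((q + i, b), (r + i, false))) ∨
      (e = wordEdge (r + i, true) (i, true) (p + i, false) (q + i, b) ∧
        s(u, v) = s((r + i, true), (i, false))) := by
  have hW : ∀ W, W ∈ symmetrizedClosure (relators n (word b p q r)) ↔ ∃ i : ZMod n,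
      W ~r letters b p q r i ∨ W ~r FreeGroup.invRev (letters b p q r i) := by
    intro W
    constructor
    · rintro ⟨r', hr, h'⟩
      obtain ⟨i, rfl⟩ := mem_relators_iff.1 hr
      rw [FreeGroup.toWord_inv, toWord_map_word h] at h'
      exact ⟨i, h'⟩
    · rintro ⟨i, h'⟩
      refine ⟨_, mem_relators_iff.2 ⟨i, rfl⟩, ?_⟩
      rwa [FreeGroup.toWord_inv, toWord_map_word h]
  have hinv : ∀ i, FreeGroup.invRev (letters b p q r i) =
      [(r + i, false), (q + i, !b), (p + i, true), (i, false)] := by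
    intro i
    simp [letters, FreeGroup.invRev]
  have hlink : ∀ a b' c d : ZMod n × Bool,
      [a, b', c, d] ∈ symmetrizedClosure (relators n (word b p q r)) →
      (starGraph (relators n (word b p q r))).IsLink (wordEdge a b' c d) a (invLetter b') := by
    intro a b' c d hm
    exact ⟨[c, d], by simpa [invLetter] using hm, by simp [wordEdge, invLetter, FreeGroup.invRev]⟩
  constructor
  · obtain ⟨u, s⟩ := u
    obtain ⟨v, t⟩ := v
    rintro ⟨w, hw, rfl⟩
    rw [hW] at hw
    obtain ⟨i, hi⟩ := hw
    rw [hinv] at hi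
    refine ⟨i, ?_⟩
    simp only [letters, isRotated_four_iff, invLetter, List.cons.injEq, Prod.mk.injEq] at hi
    rcases hi with (hi | hi | hi | hi) | (hi | hi | hi | hi) <;>
    · obtain ⟨⟨rfl, rfl⟩, ⟨rfl, ht⟩, rfl⟩ := hi
      rw [Bool.not_eq_eq_eq_not] at ht
      subst ht
      simp [FreeGroup.invRev, Sym2.eq_swap, wordEdge, invLetter]
  · rintro ⟨i, ⟨rfl, hs⟩ | ⟨rfl, hs⟩ | ⟨rfl, hs⟩ | ⟨rfl, hs⟩⟩
    · refine (hlink _ _ _ _ ((hW _).2 ⟨i, ?_⟩)).isLink_iff_sym2_eq.2 hs.symm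
      simp [letters, isRotated_four_iff]
    · refine (hlink _ _ _ _ ((hW _).2 ⟨i, ?_⟩)).isLink_iff_sym2_eq.2 hs.symm
      simp [letters, isRotated_four_iff]
    · refine (hlink _ _ _ _ ((hW _).2 ⟨i, ?_⟩)).isLink_iff_sym2_eq.2 hs.symm
      simp [letters, isRotated_four_iff]
    · refine (hlink _ _ _ _ ((hW _).2 ⟨i, ?_⟩)).isLink_iff_sym2_eq.2 hs.symm
      simp [letters, isRotated_four_iff]

end

/-! ### Star graphs labelled by residues -/

section

variable {n : ℕ}

/-- The labelling of the letters that exhibits the star graph as an order-four graph. -/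
def label (c : ZMod n) (a : ZMod n × Bool) : ZMod n := if a.2 then a.1 else a.1 + c

theorem label_true (c i : ZMod n) : label c (i, true) = i := rfl

theorem label_false (c i : ZMod n) : label c (i, false) = i + c := rfl

theorem label_fiber (c a : ZMod n) :
    ∃ x y : ZMod n × Bool, x ≠ y ∧ label c x = a ∧ label c y = a :=
  ⟨(a, true), (a - c, false), by simp, rfl, by rw [label_false]; ring⟩

theorem label_translate (c t : ZMod n) :
    ∃ f : ZMod n × Bool ≃ ZMod n × Bool, ∀ x, label c (f x) = label c x + t := by
  refine ⟨(Equiv.addRight t).prodCongr (Equiv.refl Bool), ?_⟩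
  rintro ⟨i, s⟩
  cases s
  · change i + t + c = i + c + t
    ring
  · rfl

variable [NeZero n] {b : Bool} {p q r : ZMod n}

theorem isOrderFourGraph_false (h4 : 4 * p = 0) (h2 : 2 * p ≠ 0) (hr : r = p + q) :
    IsOrderFourGraph (starGraph (relators n (word false p q r))) (label q) p := by
  have hp : p ≠ 0 := by rintro rfl; simp at h2
  have hred : IsReducedWord false p q r := ⟨hp, by simp, by simpa [hr] using hp⟩
  subst hr
  refine ⟨h4, h2, fun _ => Set.mem_univ _, ?_, ?_, label_fiber q, label_translate q⟩
  · rintro e e' ⟨u, s⟩ ⟨v, t⟩ he he'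
    rw [isLink_starGraph_iff hred] at he he'
    obtain ⟨i, he⟩ := he
    obtain ⟨j, he'⟩ := he'
    simp only [Sym2.eq_iff, Prod.mk.injEq] at he he'
    rcases he with ⟨rfl, he⟩ | ⟨rfl, he⟩ | ⟨rfl, he⟩ | ⟨rfl, he⟩ <;>
      rcases he' with ⟨rfl, he'⟩ | ⟨rfl, he'⟩ | ⟨rfl, he'⟩ | ⟨rfl, he'⟩ <;>
      first
      | obtain rfl : i = j := by grind
        rfl
      | exfalso
        grind
  · rintro ⟨u, s⟩ ⟨v, t⟩
    simp only [Graph.Adj, isLink_starGraph_iff hred, Sym2.eq_iff, Prod.mk.injEq]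
    constructor
    · rintro ⟨e, i, h⟩
      cases s <;> cases t <;> simp only [label_true, label_false] <;> grind
    · cases s <;> cases t <;> simp only [label_true, label_false]
      · rintro (h | h)
        · exact ⟨_, u - q, Or.inr (Or.inr (Or.inl ⟨rfl, by grind⟩))⟩
        · exact ⟨_, v - q, Or.inr (Or.inr (Or.inl ⟨rfl, by grind⟩))⟩
      · rintro (h | h)
        · exact ⟨_, u, Or.inr (Or.inr (Or.inr ⟨rfl, by grind⟩))⟩
        · exact ⟨_, v - q, Or.inr (Or.inl ⟨rfl, by grind⟩)⟩
      · rintro (h | h)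
        · exact ⟨_, u - q, Or.inr (Or.inl ⟨rfl, by grind⟩)⟩
        · exact ⟨_, v, Or.inr (Or.inr (Or.inr ⟨rfl, by grind⟩))⟩
      · rintro (h | h)
        · exact ⟨_, u, Or.inl ⟨rfl, by grind⟩⟩
        · exact ⟨_, v, Or.inl ⟨rfl, by grind⟩⟩

theorem isOrderFourGraph_true (h4 : 4 * p = 0) (h2 : 2 * p ≠ 0) (hq : q = 2 * r + 2 * p)
    (hq' : q = 0 ∨ q = 2 * p) :
    IsOrderFourGraph (starGraph (relators n (word true p q r))) (label (r - p)) p := by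
  have hp : p ≠ 0 := by rintro rfl; simp at h2
  have hred : IsReducedWord true p q r := ⟨hp, by grind, by simp⟩
  refine ⟨h4, h2, fun _ => Set.mem_univ _, ?_, ?_, label_fiber _, label_translate _⟩
  · rintro e e' ⟨u, s⟩ ⟨v, t⟩ he he'
    rw [isLink_starGraph_iff hred] at he he'
    obtain ⟨i, he⟩ := he
    obtain ⟨j, he'⟩ := he'
    simp only [Sym2.eq_iff, Prod.mk.injEq] at he he'
    rcases he with ⟨rfl, he⟩ | ⟨rfl, he⟩ | ⟨rfl, he⟩ | ⟨rfl, he⟩ <;>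
      rcases he' with ⟨rfl, he'⟩ | ⟨rfl, he'⟩ | ⟨rfl, he'⟩ | ⟨rfl, he'⟩ <;>
      first
      | obtain rfl : i = j := by grind
        rfl
      | exfalso
        grind
  · rintro ⟨u, s⟩ ⟨v, t⟩
    simp only [Graph.Adj, isLink_starGraph_iff hred, Sym2.eq_iff, Prod.mk.injEq]
    constructor
    · rintro ⟨e, i, h⟩
      cases s <;> cases t <;> simp only [label_true, label_false] <;> grind
    · cases s <;> cases t <;> simp only [label_true, label_false]
      · intro h
        have h : v = u + (q - p) ∨ u = v + (q - p) := by grind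
        rcases h with h | h
        · exact ⟨_, u - p, Or.inr (Or.inl ⟨rfl, by grind⟩)⟩
        · exact ⟨_, v - p, Or.inr (Or.inl ⟨rfl, by grind⟩)⟩
      · rintro (h | h)
        · exact ⟨_, u, Or.inr (Or.inr (Or.inr ⟨rfl, by grind⟩))⟩
        · have hu : u = r + (v - q) := by linear_combination -h + hq + h4
          exact ⟨_, v - q, Or.inr (Or.inr (Or.inl ⟨rfl, by simp [← hu]⟩))⟩
      · rintro (h | h)
        · have hv : v = r + (u - q) := by linear_combination h + hq + h4
          exact ⟨_, u - q, Or.inr (Or.inr (Or.inl ⟨rfl, by simp [← hv]⟩))⟩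
        · exact ⟨_, v, Or.inr (Or.inr (Or.inr ⟨rfl, by grind⟩))⟩
      · rintro (h | h)
        · exact ⟨_, u, Or.inl ⟨rfl, by grind⟩⟩
        · exact ⟨_, v, Or.inl ⟨rfl, by grind⟩⟩

end

/-! ### Characterization of the special presentations -/

/-- An element of additive order four of `ℤ/n` generates a subgroup of index `n / 4`. -/
theorem index_zmultiples_mul_four {n : ℕ} {p : ZMod n} (h4 : 4 * p = 0) (h2 : 2 * p ≠ 0) :
    (AddSubgroup.zmultiples p).index * 4 = n := by
  have ho : addOrderOf p = 4 := by
    have : addOrderOf p = 2 ^ (1 + 1) :=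
      addOrderOf_eq_prime_pow (by simpa using h2) (by norm_num; exact h4)
    simpa using this
  have := (AddSubgroup.zmultiples p).index_mul_card
  rwa [Nat.card_zmultiples, ho, Nat.card_zmod] at this

theorem isIrreduciblePresentation_word_iff {n : ℕ} {b : Bool} {p q r : ZMod n}
    (h : IsReducedWord b p q r) :
    IsIrreduciblePresentation n (word b p q r) ↔
      ∀ d : ℕ, d ∣ n → d ∣ p.val → d ∣ q.val → d ∣ r.val → d = 1 := by
  rw [IsIrreduciblePresentation, toWord_word h]
  simp only [List.map_cons, List.map_nil, List.foldr_cons, List.foldr_nil, ZMod.val_zero,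
    Nat.gcd_zero_left]
  constructor
  · intro h d hn hp hq hr
    have := Nat.dvd_gcd hp (Nat.dvd_gcd hq (Nat.dvd_gcd hr hn))
    rw [h] at this
    exact Nat.dvd_one.1 this
  · intro h
    refine h _ ?_ ?_ ?_ ?_
    · exact (Nat.gcd_dvd_right _ _).trans ((Nat.gcd_dvd_right _ _).trans (Nat.gcd_dvd_right _ _))
    · exact Nat.gcd_dvd_left _ _
    · exact (Nat.gcd_dvd_right _ _).trans (Nat.gcd_dvd_left _ _)
    · exact (Nat.gcd_dvd_right _ _).trans ((Nat.gcd_dvd_right _ _).trans (Nat.gcd_dvd_left _ _))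

section

variable {n : ℕ} [NeZero n] {b : Bool} {p q r : ZMod n} {ν : ℕ}

theorem adj_last_corner (h : IsReducedWord b p q r) (i : ZMod n) :
    (starGraph (relators n (word b p q r))).Adj (r + i, true) (i, false) :=
  ⟨_, (isLink_starGraph_iff h).2 ⟨i, Or.inr (Or.inr (Or.inr ⟨rfl, rfl⟩))⟩⟩

theorem adj_pos_pos (h : IsReducedWord b p q r) {i j : ZMod n} :
    (starGraph (relators n (word b p q r))).Adj (i, true) (j, true) ↔ j = p + i ∨ i = p + j := by
  simp only [Graph.Adj, isLink_starGraph_iff h, Sym2.eq_iff, Prod.mk.injEq]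
  cases b <;> grind

theorem adj_neg_pos_false (h : IsReducedWord false p q r) {i j : ZMod n}
    (hij : (starGraph (relators n (word false p q r))).Adj (i, false) (j, true)) :
    i = j + p - q ∨ i = j - r := by
  simp only [Graph.Adj, isLink_starGraph_iff h, Sym2.eq_iff, Prod.mk.injEq] at hij
  grind

theorem adj_neg_pos_true (h : IsReducedWord true p q r) {i j : ZMod n}
    (hij : (starGraph (relators n (word true p q r))).Adj (i, false) (j, true)) :
    i = j + r - q ∨ i = j - r := by
  simp only [Graph.Adj, isLink_starGraph_iff h, Sym2.eq_iff, Prod.mk.injEq] at hij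
  grind

theorem adj_neg_neg_true (h : IsReducedWord true p q r) {i j : ZMod n}
    (hij : (starGraph (relators n (word true p q r))).Adj (i, false) (j, false)) :
    j = i + (q - p) ∨ i = j + (q - p) := by
  simp only [Graph.Adj, isLink_starGraph_iff h, Sym2.eq_iff, Prod.mk.injEq] at hij
  grind

theorem IsSpecial.isReducedWord (h : IsSpecial 2 4 ν (relators n (word b p q r))) :
    IsReducedWord b p q r := by
  refine isReducedWord_of_length (h.length_eq _ (mem_relators_iff.2 ⟨0, ?_⟩))
  simp [FreeGroup.map.id']

/-- If `2 p = 0` then the letters `x_0` and `x_p` are joined by two edges, unless two relators are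
inverse to each other up to conjugation. -/
theorem IsSpecial.two_mul_ne_zero (h : IsSpecial 2 4 ν (relators n (word b p q r)))
    (hb : b = false → ¬ IsRedundant (relators n (word b p q r))) : 2 * p ≠ 0 := by
  intro h2
  have hred := h.isReducedWord
  have h0 := hred.1
  have l₁ := (isLink_starGraph_iff hred).2 ⟨0, Or.inl ⟨rfl, rfl⟩⟩
  have l₂ := (isLink_starGraph_iff hred).2 ⟨p, Or.inl ⟨rfl, rfl⟩⟩
  rw [show p + p = 0 by linear_combination h2] at l₂
  rw [add_zero] at l₁
  have he := h.edge_unique l₁ l₂.symm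
  simp only [wordEdge, invLetter, Sym2.eq_iff, List.cons.injEq, Prod.mk.injEq] at he
  rcases he with he | he
  · exact h0 he.1.1.1.symm
  · obtain ⟨-, -, ⟨hq, hbb⟩, ⟨hr, -⟩, -⟩ := he.1
    simp only [add_zero, Bool.not_true] at hq hr hbb
    subst hbb
    refine hb rfl ⟨_, mem_relators_iff.2 ⟨0, rfl⟩, Or.inr
      ⟨_, mem_relators_iff.2 ⟨p, rfl⟩, fun heq => ?_, Or.inr ?_⟩⟩
    · have := congrArg FreeGroup.toWord heq
      rw [toWord_map_word hred, toWord_map_word hred] at this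
      exact h0 (by simpa [letters] using this.symm)
    · rw [isConj_iff]
      refine ⟨(x q)⁻¹ * x r, ?_⟩
      simp only [word_false, map_mul, map_inv, x, FreeGroup.map.of, add_zero, zero_add, ← hr,
        show r + p = q from hq.symm,
        show p + p = 0 by linear_combination h2]
      group

/-- The ends of the path `x_{-p}, x_0, x_p, x_{2p}` are adjacent. -/
theorem IsSpecial.four_mul_eq_zero (h : IsSpecial 2 4 ν (relators n (word b p q r)))
    (h2 : 2 * p ≠ 0) : 4 * p = 0 := by
  have hred := h.isReducedWord
  have a₁ := (adj_pos_pos hred (i := -p) (j := 0)).2 (by simp)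
  have a₂ := (adj_pos_pos hred (i := 0) (j := p)).2 (by simp)
  have a₃ := (adj_pos_pos hred (i := p) (j := 2 * p)).2 (Or.inl (by ring))
  rcases (adj_pos_pos hred).1 (h.adj_of_path_three a₁ a₂ a₃) with h | h
  · exact absurd (by linear_combination h) h2
  · linear_combination -h

/-- The ends of the path `x_{-r}⁻¹, x_0, x_p, x_{2p}` are adjacent. -/
theorem IsSpecial.conditions_false (h : IsSpecial 2 4 ν (relators n (word false p q r)))
    (h2 : 2 * p ≠ 0) : r = p + q := by
  have hred := h.isReducedWord
  have h4 := h.four_mul_eq_zero h2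
  have a₁ := (adj_last_corner hred (-r)).symm
  rw [add_neg_cancel] at a₁
  have a₂ := (adj_pos_pos hred (i := 0) (j := p)).2 (by simp)
  have a₃ := (adj_pos_pos hred (i := p) (j := 2 * p)).2 (Or.inl (by ring))
  rcases adj_neg_pos_false hred (h.adj_of_path_three a₁ a₂ a₃) with h | h
  · linear_combination -h - h4
  · exact absurd (by linear_combination -h) h2

/-- The ends of the paths `x_{-r}⁻¹, x_0, x_p, x_{2p}` and `x_{-r}⁻¹, x_0, x_p, x_{p-r}⁻¹` are
adjacent. -/
theorem IsSpecial.conditions_true (h : IsSpecial 2 4 ν (relators n (word true p q r)))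
    (h2 : 2 * p ≠ 0) : q = 2 * r + 2 * p ∧ (q = 0 ∨ q = 2 * p) := by
  have hred := h.isReducedWord
  have a₁ := (adj_last_corner hred (-r)).symm
  rw [add_neg_cancel] at a₁
  have a₂ := (adj_pos_pos hred (i := 0) (j := p)).2 (by simp)
  have a₃ := (adj_pos_pos hred (i := p) (j := 2 * p)).2 (Or.inl (by ring))
  have a₄ := adj_last_corner hred (p - r)
  rw [add_sub_cancel] at a₄
  constructor
  · rcases adj_neg_pos_true hred (h.adj_of_path_three a₁ a₂ a₃) with h | h
    · linear_combination h
    · exact absurd (by linear_combination -h) h2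
  · rcases adj_neg_neg_true hred (h.adj_of_path_three a₁ a₂ a₄) with h | h
    · right
      linear_combination -h
    · left
      linear_combination -h

theorem dvd_val_of_four_mul_eq_zero (hn : n = 4 * ν) {a : ZMod n} (ha : 4 * a = 0) :
    ν ∣ a.val := by
  have : ((4 * a.val : ℕ) : ZMod n) = 0 := by
    push_cast
    rw [ZMod.natCast_zmod_val]
    exact ha
  have := (ZMod.natCast_eq_zero_iff _ _).1 this
  subst hn
  exact Nat.dvd_of_mul_dvd_mul_left (by norm_num) this

theorem order_four_iff (hn : n = 4 * ν) :
    (4 * p = 0 ∧ 2 * p ≠ 0) ↔ (p = ν ∨ p = 3 * ν) := by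
  have hν : 0 < ν := by have := NeZero.ne n; omega
  have hn0 : (4 * ν : ZMod n) = 0 := by
    have : ((4 * ν : ℕ) : ZMod n) = 0 := by rw [← hn, ZMod.natCast_self]
    exact_mod_cast this
  have h2 : (2 * ν : ZMod n) ≠ 0 := by
    intro h
    have h : ((2 * ν : ℕ) : ZMod n) = 0 := by exact_mod_cast h
    have := Nat.le_of_dvd (by omega) ((ZMod.natCast_eq_zero_iff _ _).1 h)
    omega
  constructor
  · rintro ⟨h4, hp⟩
    obtain ⟨k, hk⟩ := dvd_val_of_four_mul_eq_zero hn h4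
    have hlt := ZMod.val_lt p
    have hk4 : k < 4 := by
      by_contra! hk4
      have := Nat.mul_le_mul_left ν hk4
      omega
    have hpk : p = (ν * k : ℕ) := by rw [← hk, ZMod.natCast_zmod_val]
    interval_cases k
    · simp [hpk] at hp
    · left; simpa using hpk
    · exact absurd (by rw [hpk]; push_cast; linear_combination hn0) hp
    · right; rw [hpk]; push_cast; ring
  · rintro (rfl | rfl)
    · exact ⟨hn0, h2⟩
    · exact ⟨by linear_combination 3 * hn0, fun h => h2 (by linear_combination h - hn0)⟩

theorem IsSpecial.eq_of_eq {X : Type*} [DecidableEq X] {m k ν ν' : ℕ} {R : Set (FreeGroup X)}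
    (h : IsSpecial m k ν R) (h' : IsSpecial m k ν' R) : ν = ν' := by
  have := h.card_components.symm.trans h'.card_components
  exact_mod_cast this

theorem isSpecial_word (h4 : 4 * p = 0) (h2 : 2 * p ≠ 0)
    (h : b = false ∧ r = p + q ∨ b = true ∧ q = 2 * r + 2 * p ∧ (q = 0 ∨ q = 2 * p)) :
    IsSpecial 2 4 (AddSubgroup.zmultiples p).index (relators n (word b p q r)) := by
  have hp : p ≠ 0 := by rintro rfl; simp at h2
  have hred : IsReducedWord b p q r := by
    refine ⟨hp, ?_, ?_⟩
    · rintro rfl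
      grind
    · rintro rfl
      grind
  have hlen : ∀ w ∈ relators n (word b p q r), w.toWord.length = 4 := by
    intro w hw
    obtain ⟨i, rfl⟩ := mem_relators_iff.1 hw
    rw [toWord_map_word hred]
    rfl
  rcases h with ⟨rfl, hr⟩ | ⟨rfl, hq, hq'⟩
  · exact isSpecial_of_isOrderFourGraph (finite_relators _) hlen (isOrderFourGraph_false h4 h2 hr)
  · exact isSpecial_of_isOrderFourGraph (finite_relators _) hlen
      (isOrderFourGraph_true h4 h2 hq hq')

/-- The star graph criterion: `p` has additive order four and the remaining subscripts satisfy the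
linear conditions that make every component complete bipartite. -/
theorem isSpecial_word_iff (hb : b = false → ¬ IsRedundant (relators n (word b p q r))) :
    IsSpecial 2 4 ν (relators n (word b p q r)) ↔
      n = 4 * ν ∧ (p = ν ∨ p = 3 * ν) ∧
        (b = false ∧ r = p + q ∨ b = true ∧ q = 2 * r + 2 * p ∧ (q = 0 ∨ q = 2 * p)) := by
  constructor
  · intro h
    have h2 := h.two_mul_ne_zero hb
    have h4 := h.four_mul_eq_zero h2
    have hc : b = false ∧ r = p + q ∨ b = true ∧ q = 2 * r + 2 * p ∧ (q = 0 ∨ q = 2 * p) := by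
      cases b
      · exact Or.inl ⟨rfl, h.conditions_false h2⟩
      · exact Or.inr ⟨rfl, h.conditions_true h2⟩
    have hn : n = 4 * ν := by
      rw [← index_zmultiples_mul_four h4 h2, h.eq_of_eq (isSpecial_word h4 h2 hc), mul_comm]
    exact ⟨hn, (order_four_iff hn).1 ⟨h4, h2⟩, hc⟩
  · rintro ⟨hn, hp, hc⟩
    obtain ⟨h4, h2⟩ := (order_four_iff hn).2 hp
    have hi : (AddSubgroup.zmultiples p).index = ν := by
      have := index_zmultiples_mul_four h4 h2
      omega
    rw [← hi]
    exact isSpecial_word h4 h2 hc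

theorem isSpecial_word_false_iff (hirr : IsIrreduciblePresentation n (word false p q r))
    (hred : ¬ IsRedundant (relators n (word false p q r))) :
    IsSpecial 2 4 ν (relators n (word false p q r)) ↔
      n = 4 * ν ∧ ∃ s : ℤ, Int.gcd s ν = 1 ∧
        ((p = ν ∧ q = -s ∧ r = ν - s) ∨ (p = 3 * ν ∧ q = -s ∧ r = 3 * ν - s)) := by
  constructor
  · intro h
    have hw := h.isReducedWord
    obtain ⟨hn, hp, hc⟩ := (isSpecial_word_iff fun _ => hred).1 h
    have hr : r = p + q := by simpa using hc
    have h4 := ((order_four_iff hn).2 hp).1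
    refine ⟨hn, -(q.val : ℤ), ?_, ?_⟩
    · rw [Int.neg_gcd, Int.gcd_natCast_natCast]
      have hdn : Nat.gcd q.val ν ∣ n := (Nat.gcd_dvd_right _ _).trans ⟨4, by rw [hn, mul_comm]⟩
      have hdp : Nat.gcd q.val ν ∣ p.val :=
        (Nat.gcd_dvd_right _ _).trans (dvd_val_of_four_mul_eq_zero hn h4)
      refine (isIrreduciblePresentation_word_iff hw).1 hirr _ hdn hdp (Nat.gcd_dvd_left _ _) ?_
      rw [hr, ZMod.val_add]
      exact (Nat.dvd_mod_iff hdn).2 (dvd_add hdp (Nat.gcd_dvd_left _ _))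
    · rcases hp with hp | hp
      · left
        simp [hr, hp]
      · right
        simp [hr, hp]
  · rintro ⟨hn, s, -, h⟩
    refine (isSpecial_word_iff fun _ => hred).2 ⟨hn, ?_, Or.inl ⟨rfl, ?_⟩⟩
    · tauto
    · rcases h with ⟨rfl, rfl, rfl⟩ | ⟨rfl, rfl, rfl⟩ <;> ring

theorem isSpecial_word_true_iff (hirr : IsIrreduciblePresentation n (word true p q r)) :
    IsSpecial 2 4 ν (relators n (word true p q r)) ↔
      ν = 1 ∧ n = 4 ∧
        ((p, q, r) ∈ ({(1, 0, 1), (3, 0, 3)} : Set (ZMod n × ZMod n × ZMod n)) ∨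
         (p, q, r) ∈ ({(1, 0, 3), (3, 0, 1)} : Set (ZMod n × ZMod n × ZMod n)) ∨
         (p, q, r) ∈ ({(1, 2, 0), (3, 2, 0), (1, 2, 2), (3, 2, 2)} :
            Set (ZMod n × ZMod n × ZMod n))) := by
  simp only [Set.mem_insert_iff, Set.mem_singleton_iff, Prod.mk.injEq]
  constructor
  · intro h
    have hw := h.isReducedWord
    obtain ⟨hn, hp, hc⟩ := (isSpecial_word_iff (by simp)).1 h
    obtain ⟨hq, hq'⟩ : q = 2 * r + 2 * p ∧ (q = 0 ∨ q = 2 * p) := by simpa using hc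
    have h4 := ((order_four_iff hn).2 hp).1
    have h4q : 4 * q = 0 := by
      rcases hq' with rfl | rfl
      · simp
      · linear_combination 2 * h4
    have h4r : 4 * r = 0 := by
      rcases hq' with rfl | rfl
      · linear_combination -2 * hq - h4
      · linear_combination -2 * hq
    obtain rfl : ν = 1 := (isIrreduciblePresentation_word_iff hw).1 hirr ν ⟨4, by rw [hn, mul_comm]⟩
      (dvd_val_of_four_mul_eq_zero hn h4) (dvd_val_of_four_mul_eq_zero hn h4q)
      (dvd_val_of_four_mul_eq_zero hn h4r)
    obtain rfl : n = 4 := hn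
    refine ⟨rfl, rfl, ?_⟩
    clear * - hp hq hq'
    revert p q r
    decide
  · rintro ⟨rfl, rfl, h⟩
    refine (isSpecial_word_iff (by simp)).2 ⟨rfl, ?_, Or.inr ⟨rfl, ?_⟩⟩
    · clear * - h
      revert p q r
      decide
    · clear * - h
      revert p q r
      decide

end

/-! ### Subgroups of finite index in free groups and in simply transitive groups -/

section FreeGroups

/-- Induction on words, letter by letter from the left. -/
theorem freeGroup_induction_left {X : Type*} {P : FreeGroup X → Prop} (one : P 1)
    (of_mul : ∀ x v, P v → P (FreeGroup.of x * v))
    (of_inv_mul : ∀ x v, P v → P ((FreeGroup.of x)⁻¹ * v)) (v : FreeGroup X) : P v := by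
  obtain ⟨L⟩ := v
  induction L with
  | nil => exact one
  | cons a L ih =>
    obtain ⟨x, b⟩ := a
    cases b
    · exact of_inv_mul x _ ih
    · exact of_mul x _ ih

variable {X Y Q : Type*} [Group Q]

/-- The action of a generator on the covering of `FreeGroup Y` with sheets `Q` given by the Schreier
cocycle `c`. -/
def schreierPerm (π : FreeGroup X →* Q) (c : X → Q → FreeGroup Y) (x : X) :
    Equiv.Perm (Q × FreeGroup Y) where
  toFun z := (π (FreeGroup.of x) * z.1, c x z.1 * z.2)
  invFun z := ((π (FreeGroup.of x))⁻¹ * z.1, (c x ((π (FreeGroup.of x))⁻¹ * z.1))⁻¹ * z.2)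
  left_inv z := by simp
  right_inv z := by simp

/-- The value at a word of the Schreier cocycle determined by `c`. -/
def schreierCocycle (π : FreeGroup X →* Q) (c : X → Q → FreeGroup Y) (w : FreeGroup X) :
    FreeGroup Y :=
  (FreeGroup.lift (schreierPerm π c) w (1, 1)).2

variable {π : FreeGroup X →* Q} {c : X → Q → FreeGroup Y}

theorem schreierPerm_fst (w : FreeGroup X) (z : Q × FreeGroup Y) :
    (FreeGroup.lift (schreierPerm π c) w z).1 = π w * z.1 := by
  induction w using freeGroup_induction_left generalizing z with
  | one => simp
  | of_mul x v ih =>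
    rw [map_mul, Equiv.Perm.mul_apply, FreeGroup.lift_apply_of, map_mul, mul_assoc, ← ih z]
    rfl
  | of_inv_mul x v ih =>
    rw [map_mul, Equiv.Perm.mul_apply, map_inv, FreeGroup.lift_apply_of, map_mul, map_inv,
      mul_assoc, ← ih z]
    rfl

theorem schreierPerm_snd (w : FreeGroup X) (t : Q) (u v : FreeGroup Y) :
    (FreeGroup.lift (schreierPerm π c) w (t, u * v)) =
      ((FreeGroup.lift (schreierPerm π c) w (t, u)).1,
        (FreeGroup.lift (schreierPerm π c) w (t, u)).2 * v) := by
  induction w using freeGroup_induction_left with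
  | one => simp
  | of_mul x w ih =>
    simp only [map_mul, Equiv.Perm.mul_apply, FreeGroup.lift_apply_of, ih]
    simp [schreierPerm, mul_assoc]
  | of_inv_mul x w ih =>
    simp only [map_mul, map_inv, Equiv.Perm.mul_apply, FreeGroup.lift_apply_of, ih]
    simp [schreierPerm, mul_assoc, Equiv.Perm.inv_def]

/-- Data for the Schreier rewriting process on the kernel of `π`: a transversal `s`, elements `g` of
the kernel, and a cocycle `c` that rewrites words as some `s t` times a word in the `g y` and takes
each `g y` to the corresponding generator. -/
structure SchreierData (π : FreeGroup X →* Q) (Y : Type*) where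
  /-- The cocycle, on generators. -/
  c : X → Q → FreeGroup Y
  /-- The transversal. -/
  s : Q → FreeGroup X
  /-- The Schreier generators. -/
  g : Y → FreeGroup X
  s_one : s 1 = 1
  of_mul_s : ∀ x t, FreeGroup.of x * s t = s (π (FreeGroup.of x) * t) * FreeGroup.lift g (c x t)
  cocycle_g : ∀ y, FreeGroup.lift (schreierPerm π c) (g y) (1, 1) = (1, FreeGroup.of y)

namespace SchreierData

/-- The Schreier rewriting process: `w = s (π w) · w'`, where `w'` is the word in the Schreier
generators `g` given by the cocycle. -/
theorem rewriting (d : SchreierData π Y) (w : FreeGroup X) :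
    d.s (π w) * FreeGroup.lift d.g (schreierCocycle π d.c w) = w := by
  have key : ∀ w : FreeGroup X, d.s (FreeGroup.lift (schreierPerm π d.c) w (1, 1)).1 *
      FreeGroup.lift d.g (FreeGroup.lift (schreierPerm π d.c) w (1, 1)).2 = w := by
    intro w
    induction w using freeGroup_induction_left with
    | one => simp [d.s_one]
    | of_mul x v ih =>
      rw [map_mul, Equiv.Perm.mul_apply, FreeGroup.lift_apply_of]
      generalize FreeGroup.lift (schreierPerm π d.c) v (1, 1) = z at ih
      simp only [schreierPerm, Equiv.coe_fn_mk, map_mul]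
      rw [← mul_assoc, ← d.of_mul_s, mul_assoc, ih]
    | of_inv_mul x v ih =>
      rw [map_mul, Equiv.Perm.mul_apply, map_inv, FreeGroup.lift_apply_of]
      generalize FreeGroup.lift (schreierPerm π d.c) v (1, 1) = z at ih
      simp only [schreierPerm, Equiv.Perm.inv_def, Equiv.coe_fn_symm_mk, map_mul, map_inv]
      have h := d.of_mul_s x ((π (FreeGroup.of x))⁻¹ * z.1)
      rw [mul_inv_cancel_left] at h
      rw [← ih, eq_inv_mul_iff_mul_eq, ← mul_assoc, h]
      group
  have := key w
  rwa [schreierPerm_fst, mul_one] at this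

/-- The kernel is free on the Schreier generators. -/
theorem nonempty_ker_mulEquiv (d : SchreierData π Y) : Nonempty (π.ker ≃* FreeGroup Y) := by
  have hπ : ∀ y, d.g y ∈ π.ker := by
    intro y
    have := schreierPerm_fst (c := d.c) (d.g y) ((1, 1) : Q × FreeGroup Y) (π := π)
    rw [d.cocycle_g] at this
    simpa using this.symm
  have hker : ∀ k ∈ π.ker, FreeGroup.lift (schreierPerm π d.c) k (1, 1) =
      (1, schreierCocycle π d.c k) := by
    intro k hk
    refine Prod.ext ?_ rfl
    rw [schreierPerm_fst, hk, mul_one]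
  let f : π.ker →* FreeGroup Y :=
    { toFun := fun k => schreierCocycle π d.c k
      map_one' := by simp [schreierCocycle]
      map_mul' := by
        rintro ⟨k, hk⟩ ⟨k', hk'⟩
        simp only [Subgroup.coe_mul, schreierCocycle, map_mul, Equiv.Perm.mul_apply]
        rw [hker k' hk', show ((1 : Q), schreierCocycle π d.c k') =
            (1, 1 * schreierCocycle π d.c k') by
          rw [one_mul], schreierPerm_snd, one_mul] }
  let f' : FreeGroup Y →* π.ker := FreeGroup.lift fun y => ⟨d.g y, hπ y⟩
  have hf' : ∀ u, (f' u : FreeGroup X) = FreeGroup.lift d.g u := by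
    intro u
    refine DFunLike.congr_fun (f := π.ker.subtype.comp f') ?_ u
    ext y
    simp [f']
  refine ⟨f.toMulEquiv f' ?_ ?_⟩
  · ext ⟨k, hk⟩
    have := d.rewriting k
    rw [hk, d.s_one, one_mul] at this
    simpa [hf', f] using this
  · ext y
    simp [f', f, schreierCocycle, d.cocycle_g]

/-- A homomorphism that kills the Schreier generators kills the kernel of `π`. -/
theorem map_eq_one_of_mem_ker {M : Type*} [Group M] (d : SchreierData π Y) (f : FreeGroup X →* M)
    (hf : ∀ y, f (d.g y) = 1) {k : FreeGroup X} (hk : k ∈ π.ker) : f k = 1 := by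
  have := d.rewriting k
  rw [hk, d.s_one, one_mul] at this
  rw [← this, ← MonoidHom.comp_apply, show f.comp (FreeGroup.lift d.g) = 1 by ext y; simp [hf],
    MonoidHom.one_apply]

end SchreierData

/-- The homomorphism from the free group on `a, b` to `ℤ/m` with `a, b ↦ 1`. -/
def expSum (m : ℕ) : F 2 →* Multiplicative (ZMod m) :=
  FreeGroup.lift fun _ => Multiplicative.ofAdd 1

/-- The homomorphism from the free group on `a, b` to `(ℤ/2)²` recording the parities of the two
exponent sums. -/
def parities : F 2 →* Multiplicative (ZMod 2 × ZMod 2) :=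
  FreeGroup.lift ![Multiplicative.ofAdd (1, 0), Multiplicative.ofAdd (0, 1)]

/-- The first free generator. -/
abbrev genA : F 2 := FreeGroup.of 0

/-- The second free generator. -/
abbrev genB : F 2 := FreeGroup.of 1

/-- Schreier data for the kernel of `expSum 2`, with transversal `1, a`. -/
def schreierTwo : SchreierData (expSum 2) (Fin 3) where
  c x t := if x = 0 then (if t.toAdd = 1 then FreeGroup.of 2 else 1)
    else FreeGroup.of (Fin.castLE (by norm_num) (t.toAdd : Fin 2))
  s t := genA ^ t.toAdd.val
  g := ![genA⁻¹ * genB, genB * genA, genA ^ 2]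
  s_one := by decide
  of_mul_s := by decide
  cocycle_g := by decide

/-- Schreier data for the kernel of `expSum 4`, with transversal `1, a, a², a³`. -/
def schreierFour : SchreierData (expSum 4) (Fin 5) where
  c x t := if x = 0 then (if t.toAdd = 3 then FreeGroup.of 4 else 1)
    else FreeGroup.of (Fin.castLE (by norm_num) (t.toAdd : Fin 4))
  s t := genA ^ t.toAdd.val
  g := ![genA⁻¹ * genB, genA⁻¹ ^ 2 * genB * genA, genA⁻¹ ^ 3 * genB * genA ^ 2, genB * genA ^ 3,
    genA ^ 4]
  s_one := by decide
  of_mul_s := by decide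
  cocycle_g := by decide

/-- Schreier data for the kernel of `parities`, with transversal `1, a, b, ab`. -/
def schreierParities : SchreierData parities (Fin 5) where
  c x t :=
    if x = 0 then
      (if t.toAdd = (1, 0) then FreeGroup.of 0 else if t.toAdd = (1, 1) then FreeGroup.of 1 else 1)
    else
      (if t.toAdd = (0, 1) then FreeGroup.of 2 else if t.toAdd = (1, 0) then FreeGroup.of 3 else
        if t.toAdd = (1, 1) then FreeGroup.of 4 else 1)
  s t := genA ^ t.toAdd.1.val * genB ^ t.toAdd.2.val
  g := ![genA ^ 2, genB⁻¹ * genA ^ 2 * genB, genB ^ 2, genB⁻¹ * genA⁻¹ * genB * genA,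
    genA⁻¹ * genB * genA * genB]
  s_one := by decide
  of_mul_s := by decide
  cocycle_g := by decide

theorem map_eq_one_of_mem_ker_expSum_four {M : Type*} [Group M] (f : F 2 →* M)
    (h4 : f genA ^ 4 = 1) (hab : f genB = f genA) {k : F 2} (hk : k ∈ (expSum 4).ker) :
    f k = 1 := by
  refine schreierFour.map_eq_one_of_mem_ker f (fun y => ?_) hk
  fin_cases y <;> simp [schreierFour, hab, pow_succ, mul_assoc] <;>
    simpa [pow_succ, mul_assoc] using h4

theorem map_eq_one_of_mem_ker_parities {M : Type*} [Group M] (f : F 2 →* M)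
    (ha : f genA ^ 2 = 1) (hb : f genB ^ 2 = 1) (hab : f genA * f genB = f genB * f genA) {k : F 2}
    (hk : k ∈ parities.ker) : f k = 1 := by
  refine schreierParities.map_eq_one_of_mem_ker f (fun y => ?_) hk
  have hb' : f genB * f genB = 1 := by rw [← pow_two, hb]
  fin_cases y
  · simpa [schreierParities] using ha
  · simp [schreierParities, ha]
  · simpa [schreierParities] using hb
  · have : (f genB)⁻¹ * ((f genA)⁻¹ * (f genB * f genA)) = 1 := by rw [← hab]; group
    simpa [schreierParities, mul_assoc] using this
  · have : (f genA)⁻¹ * (f genB * (f genA * f genB)) = 1 := by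
      rw [← mul_assoc (f genB), ← hab, mul_assoc, hb', mul_one, inv_mul_cancel]
    simpa [schreierParities, mul_assoc] using this

theorem surjective_expSum (m : ℕ) [NeZero m] : Function.Surjective (expSum m) := by
  intro t
  refine ⟨genA ^ t.toAdd.val, ?_⟩
  rw [map_pow, expSum, FreeGroup.lift_apply_of, ← ofAdd_nsmul]
  simp

theorem index_ker_expSum (m : ℕ) [NeZero m] : (expSum m).ker.index = m := by
  rw [Subgroup.index_ker, MonoidHom.range_eq_top.2 (surjective_expSum m)]
  simp

theorem index_ker_parities : parities.ker.index = 4 := by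
  have hs : Function.Surjective parities := by
    intro t
    exact ⟨schreierParities.s t, by revert t; decide⟩
  rw [Subgroup.index_ker, MonoidHom.range_eq_top.2 hs]
  simp

end FreeGroups

section Transitive

variable {G Γ : Type*} [Group G] [Group Γ]

/-- The elements of `G` that act on `Γ` as left multiplication by an element of `K`. -/
def translationSubgroup (A : G →* Equiv.Perm Γ) (K : Subgroup Γ) : Subgroup G :=
  (K.map (MulAction.toPermHom Γ Γ)).comap A

theorem mem_translationSubgroup {A : G →* Equiv.Perm Γ} {K : Subgroup Γ} {g : G} :
    g ∈ translationSubgroup A K ↔ ∃ k ∈ K, ∀ γ, A g γ = k * γ := by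
  simp only [translationSubgroup, Subgroup.mem_comap, Subgroup.mem_map]
  refine exists_congr fun k => and_congr_right fun _ => ?_
  rw [eq_comm, Equiv.Perm.ext_iff]
  rfl

variable {A : G →* Equiv.Perm Γ} {K : Subgroup Γ}

theorem eq_of_map_one_eq (hfree : ∀ g, A g 1 = 1 → g = 1) {g h : G} (he : A g 1 = A h 1) :
    g = h := by
  refine (inv_mul_eq_one.1 (hfree (h⁻¹ * g) ?_)).symm
  rw [map_mul, Equiv.Perm.mul_apply, he, ← Equiv.Perm.mul_apply, ← map_mul, inv_mul_cancel]
  simp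

/-- If `G` acts freely on the set `Γ` and realizes the left multiplications by elements of `K`, then
these make up a copy of `K` in `G`. -/
theorem nonempty_translationSubgroup_mulEquiv (hfree : ∀ g, A g 1 = 1 → g = 1)
    (hK : ∀ k ∈ K, ∃ g, ∀ γ, A g γ = k * γ) : Nonempty (translationSubgroup A K ≃* K) := by
  have hS : ∀ g ∈ translationSubgroup A K, A g 1 ∈ K ∧ ∀ γ, A g γ = A g 1 * γ := by
    intro g hg
    obtain ⟨k, hk, h⟩ := mem_translationSubgroup.1 hg
    rw [h 1, mul_one]
    exact ⟨hk, h⟩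
  let f : translationSubgroup A K →* K :=
    { toFun := fun g => ⟨A g.1 1, (hS _ g.2).1⟩
      map_one' := by ext; simp
      map_mul' := fun g h => by ext; simp [← (hS _ g.2).2] }
  refine ⟨MulEquiv.ofBijective f ⟨?_, ?_⟩⟩
  · rintro ⟨g, hg⟩ ⟨h, hh⟩ he
    exact Subtype.ext (eq_of_map_one_eq hfree (congrArg Subtype.val he))
  · rintro ⟨k, hk⟩
    obtain ⟨g, hg⟩ := hK k hk
    exact ⟨⟨g, mem_translationSubgroup.2 ⟨k, hk, hg⟩⟩, Subtype.ext (by simp [f, hg])⟩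

/-- If `G` acts simply transitively on the set `Γ` and realizes the left multiplications by elements
of `K`, then these form a subgroup of `G` whose index is that of `K` in `Γ`. -/
theorem index_translationSubgroup (hfree : ∀ g, A g 1 = 1 → g = 1)
    (htrans : ∀ γ, ∃ g, A g 1 = γ) (hK : ∀ k ∈ K, ∃ g, ∀ γ, A g γ = k * γ) :
    (translationSubgroup A K).index = K.index := by
  -- The inverses turn right cosets, which are orbits of left multiplications, into left cosets.
  let f : G ≃ Γ := Equiv.ofBijective (fun g => (A g⁻¹ 1)⁻¹) <| by
    constructor
    · intro g h he
      exact inv_injective (eq_of_map_one_eq hfree (inv_injective he))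
    · intro γ
      obtain ⟨g, hg⟩ := htrans γ⁻¹
      exact ⟨g⁻¹, by simp [hg]⟩
  have hf : ∀ g, f g = (A g⁻¹ 1)⁻¹ := fun _ => rfl
  refine Nat.card_congr (Quotient.congr f fun g h => ?_)
  rw [QuotientGroup.leftRel_apply, QuotientGroup.leftRel_apply, mem_translationSubgroup]
  rw [hf, hf, inv_inv]
  constructor
  · rintro ⟨k, hk, hgh⟩
    have : A g⁻¹ 1 = k * A h⁻¹ 1 := by
      rw [← hgh, ← Equiv.Perm.mul_apply, ← map_mul, mul_inv_cancel_right]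
    rw [this, mul_inv_cancel_right]
    exact hk
  · intro hk
    obtain ⟨g', hg'⟩ := hK _ hk
    refine ⟨_, hk, ?_⟩
    have : g' * h⁻¹ = g⁻¹ := eq_of_map_one_eq hfree
      (by rw [map_mul, Equiv.Perm.mul_apply, hg']; group)
    have : g⁻¹ * h = g' := by rw [← this, inv_mul_cancel_right]
    rw [this]
    exact hg'

end Transitive

/-! ### Cyclically presented groups: homomorphisms and free subgroups -/

section CyclicGroups

variable {n : ℕ} {H : Type*} [Group H]

theorem lift_map_word (f : ZMod n → H) (b : Bool) (p q r i : ZMod n) :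
    FreeGroup.lift f (FreeGroup.map (· + i) (word b p q r)) =
      f i * (f (p + i))⁻¹ * cond b (f (q + i)) (f (q + i))⁻¹ * f (r + i) := by
  rw [word, FreeGroup.map.mk, FreeGroup.lift_mk]
  simp [mul_assoc]

/-- The homomorphism from a cyclically presented group given by the images of the generators. -/
def cyclicLift [NeZero n] {w : FreeGroup (ZMod n)} (f : ZMod n → H)
    (h : ∀ i, FreeGroup.lift f (FreeGroup.map (· + i) w) = 1) : CyclicGroup n w →* H :=
  PresentedGroup.toGroup (f := f) fun r hr => by
    obtain ⟨i, rfl⟩ := mem_relators_iff.1 hr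
    exact h i

@[simp]
theorem cyclicLift_of [NeZero n] {w : FreeGroup (ZMod n)} (f : ZMod n → H)
    (h : ∀ i, FreeGroup.lift f (FreeGroup.map (· + i) w) = 1) (i : ZMod n) :
    cyclicLift f h (PresentedGroup.of i) = f i :=
  PresentedGroup.toGroup.of _

theorem lift_of_map_eq_one [NeZero n] (w : FreeGroup (ZMod n)) (i : ZMod n) :
    FreeGroup.lift (PresentedGroup.of (rels := relators n w)) (FreeGroup.map (· + i) w) = 1 := by
  have : FreeGroup.lift (PresentedGroup.of (rels := relators n w)) =
      PresentedGroup.mk (relators n w) := by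
    ext j
    simp [PresentedGroup.of]
  rw [this]
  exact PresentedGroup.one_of_mem (mem_relators_iff.2 ⟨i, rfl⟩)

theorem relation [NeZero n] (b : Bool) (p q r i : ZMod n) :
    (PresentedGroup.of i * (PresentedGroup.of (p + i))⁻¹ *
      cond b (PresentedGroup.of (q + i)) (PresentedGroup.of (q + i))⁻¹ * PresentedGroup.of (r + i) :
      CyclicGroup n (word b p q r)) = 1 := by
  rw [← lift_map_word]
  exact lift_of_map_eq_one _ i

theorem cyclicGroup_induction {w : FreeGroup (ZMod n)} {P : CyclicGroup n w → Prop} (one : P 1)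
    (of_mul : ∀ i g, P g → P (PresentedGroup.of i * g))
    (of_inv_mul : ∀ i g, P g → P ((PresentedGroup.of i)⁻¹ * g)) (g : CyclicGroup n w) : P g := by
  obtain ⟨v, rfl⟩ := PresentedGroup.mk_surjective _ g
  induction v using freeGroup_induction_left with
  | one => simpa using one
  | of_mul i v ih => rw [map_mul]; exact of_mul i _ ih
  | of_inv_mul i v ih => rw [map_mul, map_inv]; exact of_inv_mul i _ ih

/-- Homomorphisms between cyclically presented groups that are mutually inverse on generators. -/
theorem nonempty_cyclicGroup_mulEquiv {w w' : FreeGroup (ZMod n)}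
    (f : CyclicGroup n w →* CyclicGroup n w') (f' : CyclicGroup n w' →* CyclicGroup n w)
    (h : ∀ i, f' (f (PresentedGroup.of i)) = PresentedGroup.of i)
    (h' : ∀ i, f (f' (PresentedGroup.of i)) = PresentedGroup.of i) :
    Nonempty (CyclicGroup n w ≃* CyclicGroup n w') :=
  ⟨f.toMulEquiv f' (PresentedGroup.ext h) (PresentedGroup.ext h')⟩

theorem mul_inv_mul_inv_mul_eq_one_iff {a b c d : H} :
    a * b⁻¹ * c⁻¹ * d = 1 ↔ c * b = d * a := by
  rw [mul_assoc a, ← mul_inv_rev, mul_eq_one_iff_eq_inv, mul_inv_eq_iff_eq_mul,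
    eq_inv_mul_iff_mul_eq, eq_comm]

theorem lift_map_word_eq_one {f : ZMod n → H} {p q : ZMod n}
    (h : ∀ i, f (q + i) * f (p + i) = f (p + q + i) * f i) (i : ZMod n) :
    FreeGroup.lift f (FreeGroup.map (· + i) (word false p q (p + q))) = 1 := by
  rw [lift_map_word]
  exact mul_inv_mul_inv_mul_eq_one_iff.2 (h i)

variable [NeZero n]

/-- Negating all subscripts does not change the group. -/
theorem nonempty_mulEquiv_neg (b : Bool) {p q r p' q' r' : ZMod n} (hp : p' = -p) (hq : q' = -q)
    (hr : r' = -r) :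
    Nonempty (CyclicGroup n (word b p q r) ≃* CyclicGroup n (word b p' q' r')) := by
  have key : ∀ (p q r : ZMod n) (i : ZMod n),
      FreeGroup.lift (fun j => (PresentedGroup.of (-j) : CyclicGroup n (word b (-p) (-q) (-r))))
        (FreeGroup.map (· + i) (word b p q r)) = 1 := by
    intro p q r i
    have := relation b (-p) (-q) (-r) (-i)
    rw [lift_map_word]
    simp only [neg_add]
    exact this
  subst hp hq hr
  have key' := key (-p) (-q) (-r)
  rw [neg_neg, neg_neg, neg_neg] at key'
  refine nonempty_cyclicGroup_mulEquiv (cyclicLift _ (key p q r)) (cyclicLift _ key')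
    (fun i => ?_) (fun i => ?_) <;>
  simp

/-- The inverse of a relator `x_i x_{p+i}⁻¹ x_{q+i}⁻¹ x_{p+q+i}` is, up to cyclic permutation, a
relator of the same form with `-p` for `p`. -/
theorem nonempty_mulEquiv_neg_left {p q r p' r' : ZMod n} (hr : r = p + q) (hp : p' = -p)
    (hr' : r' = q - p) :
    Nonempty (CyclicGroup n (word false p q r) ≃* CyclicGroup n (word false p' q r')) := by
  have key : ∀ (p i : ZMod n),
      FreeGroup.lift (fun j => (PresentedGroup.of j : CyclicGroup n (word false (-p) q (q - p))))
        (FreeGroup.map (· + i) (word false p q (p + q))) = 1 := by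
    intro p i
    have := relation false (-p) q (q - p) (p + i)
    rw [lift_map_word]
    rw [neg_add_cancel_left, show q - p + (p + i) = q + i by ring,
      show q + (p + i) = p + q + i by ring] at this
    simp only [cond_false] at this ⊢
    generalize (PresentedGroup.of i : CyclicGroup n (word false (-p) q (q - p))) = a at *
    generalize (PresentedGroup.of (p + i) : CyclicGroup n (word false (-p) q (q - p))) = b at *
    generalize (PresentedGroup.of (q + i) : CyclicGroup n (word false (-p) q (q - p))) = c at *
    generalize (PresentedGroup.of (p + q + i) : CyclicGroup n (word false (-p) q (q - p))) = d at *
    have h1 : b * a⁻¹ = c⁻¹ * d := by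
      rw [mul_assoc, mul_eq_one_iff_eq_inv] at this
      rw [this]
      group
    have h2 : a * b⁻¹ = d⁻¹ * c := by
      rw [← inv_inj]
      simpa using h1
    rw [h2]
    group
  subst hr hp hr'
  have key' := key (-p)
  rw [neg_neg, sub_neg_eq_add, neg_add_eq_sub, add_comm q p] at key'
  refine nonempty_cyclicGroup_mulEquiv (cyclicLift _ (key p)) (cyclicLift _ key')
    (fun i => ?_) (fun i => ?_) <;>
  simp

/-- The relation `x_i x_{p+i}⁻¹ x_{q+i}⁻¹ x_{p+q+i} = 1` says that `x_i` and `x_{p+i}` commute up to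
the shift by `q`: `x_{q+i} x_{p+i} = x_{q+p+i} x_i`. -/
theorem twisted_commutation (p q i : ZMod n) :
    (PresentedGroup.of (q + i) * PresentedGroup.of (p + i) : CyclicGroup n (word false p q (p + q)))
      = PresentedGroup.of (p + q + i) * PresentedGroup.of i :=
  mul_inv_mul_inv_mul_eq_one_iff.1 (relation false p q (p + q) i)

/-- Identifying `x_i` with `x_{i+ν}` makes all relators trivial. -/
theorem exists_epimorphism {ν : ℕ} (hn : n = 4 * ν) {p : ZMod n} (hp : p = ν ∨ p = 3 * ν)
    (q : ZMod n) : ∃ f : CyclicGroup n (word false p q (p + q)) →* F ν, Function.Surjective f := by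
  have : NeZero ν := ⟨by have := NeZero.ne n; omega⟩
  have hdvd : ν ∣ n := ⟨4, by rw [hn, mul_comm]⟩
  let c : ZMod n →+* ZMod ν := ZMod.castHom hdvd (ZMod ν)
  have hc : c p = 0 := by rcases hp with rfl | rfl <;> simp
  let e : ZMod n → F ν := fun i => FreeGroup.of ((ZMod.finEquiv ν).symm (c i))
  refine ⟨cyclicLift e (lift_map_word_eq_one fun i => ?_), fun u => ?_⟩
  · simp only [e, map_add, hc, zero_add]
  · induction u using freeGroup_induction_left with
    | one => exact ⟨1, map_one _⟩
    | of_mul j u ih =>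
      obtain ⟨g, rfl⟩ := ih
      obtain ⟨i, hi⟩ := ZMod.castHom_surjective hdvd (ZMod.finEquiv ν j)
      refine ⟨PresentedGroup.of i * g, ?_⟩
      rw [map_mul, cyclicLift_of]
      simp only [e, c, hi, RingEquiv.symm_apply_apply]
    | of_inv_mul j u ih =>
      obtain ⟨g, rfl⟩ := ih
      obtain ⟨i, hi⟩ := ZMod.castHom_surjective hdvd (ZMod.finEquiv ν j)
      refine ⟨(PresentedGroup.of i)⁻¹ * g, ?_⟩
      rw [map_mul, map_inv, cyclicLift_of]
      simp only [e, c, hi, RingEquiv.symm_apply_apply]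

theorem isLarge_of_surjective {G : Type*} [Group G] {ν : ℕ} (hν : 1 < ν) {f : G →* F ν}
    (hf : Function.Surjective f) : IsLarge G := by
  have : Nontrivial (Fin ν) := Fin.nontrivial_iff_two_le.2 hν
  exact ⟨⊤, inferInstance, Fin ν, this, f.comp (Subgroup.subtype ⊤),
    hf.comp fun g => ⟨⟨g, trivial⟩, rfl⟩⟩

end CyclicGroups

section ProductOfFreeGroups

theorem commute_lift {X Y G : Type*} [Group G] {f : X → G} {g : Y → G}
    (h : ∀ x y, Commute (f x) (g y)) (u : FreeGroup X) (v : FreeGroup Y) :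
    Commute (FreeGroup.lift f u) (FreeGroup.lift g v) := by
  have h' : ∀ x, Commute (f x) (FreeGroup.lift g v) := by
    intro x
    induction v using freeGroup_induction_left with
    | one => simp
    | of_mul y v ih => simpa using (h x y).mul_right ih
    | of_inv_mul y v ih => simpa using (h x y).inv_right.mul_right ih
  induction u using freeGroup_induction_left with
  | one => simp
  | of_mul x u ih => simpa using (h' x).mul_left ih
  | of_inv_mul x u ih => simpa using (h' x).inv_left.mul_left ih

/-- The involution of the free group on `a, b` with `a ↦ b⁻¹` and `b ↦ a⁻¹`. -/
def swapInv : F 2 ≃* F 2 :=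
  (FreeGroup.lift ![genB⁻¹, genA⁻¹]).toMulEquiv (FreeGroup.lift ![genB⁻¹, genA⁻¹])
    (by ext i; fin_cases i <;> simp) (by ext i; fin_cases i <;> simp)

theorem swapInv_genA_inv : swapInv genA⁻¹ = genB := by
  change FreeGroup.lift ![genB⁻¹, genA⁻¹] genA⁻¹ = genB
  simp

variable {n : ℕ} {p q : ZMod n}

/-- Permutations of the free group on `a, b` indexed by the generators, trivial except at `d` and
`d + 2 p`: these two are chosen so that `y_d⁻¹ y_{d+2p}` and `y_d y_{d+2p}⁻¹` are the left
multiplications by `a` and `b`. -/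
def pairPerm (p d k : ZMod n) : Equiv.Perm (F 2) :=
  if k = d then swapInv.toEquiv
  else if k = d + 2 * p then swapInv.toEquiv * Equiv.mulLeft genA
  else 1

theorem pairPerm_self (p d : ZMod n) : pairPerm p d d = swapInv.toEquiv := if_pos rfl

theorem pairPerm_opposite (h2 : 2 * p ≠ 0) (d : ZMod n) :
    pairPerm p d (d + 2 * p) = swapInv.toEquiv * Equiv.mulLeft genA := by
  rw [pairPerm, if_neg (by simpa using h2), if_pos rfl]

theorem pairPerm_eq_one {p d k : ZMod n} (h : k ≠ d) (h' : k ≠ d + 2 * p) : pairPerm p d k = 1 := by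
  rw [pairPerm, if_neg h, if_neg h']

theorem pairPerm_commute (h4 : 4 * p = 0) (h2 : 2 * p ≠ 0) (d k : ZMod n) :
    pairPerm p d k * pairPerm p d (p + k) = pairPerm p d (p + k) * pairPerm p d k := by
  have h0 : p ≠ 0 := by rintro rfl; simp at h2
  have h3 : 3 * p ≠ 0 := fun h => h0 (by linear_combination h4 - h)
  by_cases h : k ≠ d ∧ k ≠ d + 2 * p
  · rw [pairPerm_eq_one h.1 h.2, one_mul, mul_one]
  · rw [pairPerm_eq_one (k := p + k) (by grind) (by grind), one_mul, mul_one]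

/-- The permutation of `F_2 × ℤ/n` by which the generator `x_i` acts: the twist by `q` in the
relations is absorbed by the second component. -/
def twistedPerm (p q d i : ZMod n) : Equiv.Perm (F 2 × ZMod n) where
  toFun z := (pairPerm p d (i + z.2 * q) z.1, z.2 - 1)
  invFun z := ((pairPerm p d (i + (z.2 + 1) * q))⁻¹ z.1, z.2 + 1)
  left_inv z := by simp [Equiv.Perm.inv_def]
  right_inv z := by simp [Equiv.Perm.inv_def]

theorem twistedPerm_apply (p q d i : ZMod n) (u : F 2) (e : ZMod n) :
    twistedPerm p q d i (u, e) = (pairPerm p d (i + e * q) u, e - 1) := rfl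

theorem twistedPerm_inv_apply (p q d i : ZMod n) (u : F 2) (e : ZMod n) :
    (twistedPerm p q d i)⁻¹ (u, e) = ((pairPerm p d (i + (e + 1) * q))⁻¹ u, e + 1) := rfl

variable [NeZero n]

/-- The action on `F_2 × ℤ/n` of the group given by the relators
`x_i x_{p+i}⁻¹ x_{q+i}⁻¹ x_{p+q+i}`. -/
def twistedAction (h4 : 4 * p = 0) (h2 : 2 * p ≠ 0) (q d : ZMod n) :
    CyclicGroup n (word false p q (p + q)) →* Equiv.Perm (F 2 × ZMod n) :=
  cyclicLift (twistedPerm p q d) <| lift_map_word_eq_one fun i => by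
    ext1 ⟨u, e⟩
    simp only [Equiv.Perm.mul_apply, twistedPerm_apply]
    rw [show q + i + (e - 1) * q = i + e * q by ring,
      show p + q + i + (e - 1) * q = p + (i + e * q) by ring,
      show p + i + e * q = p + (i + e * q) by ring, ← Equiv.Perm.mul_apply, ← Equiv.Perm.mul_apply,
      pairPerm_commute h4 h2]

/-- The elements `x_d⁻¹ x_{d+2p}` and `x_{d-q} x_{d-q+2p}⁻¹`, which generate a free group. -/
def pairElement (p q d : ZMod n) : Fin 2 → CyclicGroup n (word false p q (p + q)) :=
  ![(PresentedGroup.of d)⁻¹ * PresentedGroup.of (d + 2 * p),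
    PresentedGroup.of (d - q) * (PresentedGroup.of (d - q + 2 * p))⁻¹]

theorem twistedAction_of (h4 : 4 * p = 0) (h2 : 2 * p ≠ 0) (q d i : ZMod n) :
    twistedAction h4 h2 q d (PresentedGroup.of i) = twistedPerm p q d i :=
  cyclicLift_of _ _ i

theorem twistedAction_pairElement (h4 : 4 * p = 0) (h2 : 2 * p ≠ 0) (d : ZMod n) (j : Fin 2)
    (u : F 2) : twistedAction h4 h2 q d (pairElement p q d j) (u, 0) = (FreeGroup.of j * u, 0) := by
  fin_cases j
  · change twistedAction h4 h2 q d ((PresentedGroup.of d)⁻¹ * PresentedGroup.of (d + 2 * p)) (u, 0)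
      = (genA * u, 0)
    rw [map_mul, map_inv, twistedAction_of, twistedAction_of, Equiv.Perm.mul_apply,
      twistedPerm_apply, twistedPerm_inv_apply, zero_mul, add_zero, zero_sub, neg_add_cancel,
      zero_mul, add_zero, pairPerm_self, pairPerm_opposite h2]
    simp
  · change twistedAction h4 h2 q d (PresentedGroup.of (d - q) *
      (PresentedGroup.of (d - q + 2 * p))⁻¹) (u, 0) = (genB * u, 0)
    rw [map_mul, map_inv, twistedAction_of, twistedAction_of, Equiv.Perm.mul_apply,
      twistedPerm_inv_apply, twistedPerm_apply, zero_add, one_mul,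
      show d - q + 2 * p + q = d + 2 * p by ring, sub_add_cancel, sub_self, pairPerm_self,
      pairPerm_opposite h2, mul_inv_rev, ← swapInv_genA_inv]
    simp [Equiv.Perm.inv_def]

/-- The pair at `d + p` acts trivially where the pair at `d` acts by left multiplications. -/
theorem twistedAction_pairElement_add (h4 : 4 * p = 0) (h2 : 2 * p ≠ 0) (d : ZMod n) (j : Fin 2)
    (u : F 2) : twistedAction h4 h2 q d (pairElement p q (d + p) j) (u, 0) = (u, 0) := by
  have h0 : p ≠ 0 := by rintro rfl; simp at h2
  have h3 : 3 * p ≠ 0 := fun h => h0 (by linear_combination h4 - h)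
  have e₁ : pairPerm p d (d + p) = 1 := pairPerm_eq_one (by grind) (by grind)
  have e₃ : pairPerm p d (d + p + 2 * p) = 1 := pairPerm_eq_one (by grind) (by grind)
  fin_cases j
  · change twistedAction h4 h2 q d ((PresentedGroup.of (d + p))⁻¹ *
      PresentedGroup.of (d + p + 2 * p)) (u, 0) = (u, 0)
    rw [map_mul, map_inv, twistedAction_of, twistedAction_of, Equiv.Perm.mul_apply,
      twistedPerm_apply, twistedPerm_inv_apply, zero_mul, add_zero, zero_sub, neg_add_cancel,
      zero_mul, add_zero, e₁, e₃]
    simp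
  · change twistedAction h4 h2 q d (PresentedGroup.of (d + p - q) *
      (PresentedGroup.of (d + p - q + 2 * p))⁻¹) (u, 0) = (u, 0)
    rw [map_mul, map_inv, twistedAction_of, twistedAction_of, Equiv.Perm.mul_apply,
      twistedPerm_inv_apply, twistedPerm_apply, zero_add, one_mul,
      show d + p - q + 2 * p + q = d + p + 2 * p by ring, sub_add_cancel, sub_self, e₁, e₃]
    simp

theorem twistedAction_lift (h4 : 4 * p = 0) (h2 : 2 * p ≠ 0) (d : ZMod n) (v u : F 2) :
    twistedAction h4 h2 q d (FreeGroup.lift (pairElement p q d) v) (u, 0) = (v * u, 0) := by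
  induction v using freeGroup_induction_left with
  | one => simp
  | of_mul j v ih =>
    rw [map_mul, map_mul, Equiv.Perm.mul_apply, ih, FreeGroup.lift_apply_of,
      twistedAction_pairElement, mul_assoc]
  | of_inv_mul j v ih =>
    rw [map_mul, map_mul, Equiv.Perm.mul_apply, ih, map_inv, map_inv, FreeGroup.lift_apply_of,
      Equiv.Perm.inv_eq_iff_eq, twistedAction_pairElement, mul_assoc, mul_inv_cancel_left]

theorem twistedAction_lift_add (h4 : 4 * p = 0) (h2 : 2 * p ≠ 0) (d : ZMod n) (v u : F 2) :
    twistedAction h4 h2 q d (FreeGroup.lift (pairElement p q (d + p)) v) (u, 0) = (u, 0) := by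
  induction v using freeGroup_induction_left with
  | one => simp
  | of_mul j v ih =>
    rw [map_mul, map_mul, Equiv.Perm.mul_apply, ih, FreeGroup.lift_apply_of,
      twistedAction_pairElement_add]
  | of_inv_mul j v ih =>
    rw [map_mul, map_mul, Equiv.Perm.mul_apply, ih, map_inv, map_inv, FreeGroup.lift_apply_of,
      Equiv.Perm.inv_eq_iff_eq, twistedAction_pairElement_add]

/-- The twisted commutation relation also holds for `x_i` and `x_{i-p}`. -/
theorem twisted_commutation' {i j : ZMod n} (h : j = p + i ∨ i = p + j) :
    (PresentedGroup.of (q + i) * PresentedGroup.of j : CyclicGroup n (word false p q (p + q)))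
      = PresentedGroup.of (q + j) * PresentedGroup.of i := by
  rcases h with rfl | rfl
  · rw [twisted_commutation, show p + q + i = q + (p + i) by ring]
  · rw [show q + (p + j) = p + q + j by ring, ← twisted_commutation]

theorem commute_of_conj_eq {G : Type*} [Group G] {u v a b : G} (ha : v = a⁻¹ * u * a)
    (hb : v = b⁻¹ * u * b) : Commute v (a⁻¹ * b) ∧ Commute u (a * b⁻¹) := by
  have ha' : u * a = a * v := by rw [ha]; group
  have hb' : u * b = b * v := by rw [hb]; group
  constructor
  · change v * (a⁻¹ * b) = a⁻¹ * b * v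
    rw [mul_assoc a⁻¹, ← hb', ha]
    group
  · change u * (a * b⁻¹) = a * b⁻¹ * u
    rw [← mul_assoc, ha', mul_assoc, mul_assoc, mul_right_inj, eq_inv_mul_iff_mul_eq, ← mul_assoc,
      ← hb', mul_inv_cancel_right]

theorem commute_pairElement (h4 : 4 * p = 0) (d : ZMod n) (j k : Fin 2) :
    Commute (pairElement p q d j) (pairElement p q (d + p) k) := by
  let y : ZMod n → CyclicGroup n (word false p q (p + q)) := PresentedGroup.of
  have hy : ∀ i j : ZMod n, (j = p + i ∨ i = p + j) → y (q + i) * y j = y (q + j) * y i :=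
    fun i j h => twisted_commutation' h
  -- For `j = i ± p`, conjugation by `x_j` shifts `x_i x_{i+2p}⁻¹` and `x_i⁻¹ x_{i+2p}` by `q`.
  have hu : ∀ i j : ZMod n, (j = p + i ∨ i = p + j) →
      y (i - q) * (y (i - q + 2 * p))⁻¹ = (y j)⁻¹ * (y i * (y (i + 2 * p))⁻¹) * y j := by
    intro i j h
    have h₁ := hy (i - q) (j - q) (by grind)
    have h₂ := hy (i - q + 2 * p) (j - q) (by grind)
    rw [add_sub_cancel, add_sub_cancel] at h₁
    rw [show q + (i - q + 2 * p) = i + 2 * p by ring, add_sub_cancel] at h₂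
    rw [eq_inv_mul_iff_mul_eq.2 h₁.symm, eq_inv_mul_iff_mul_eq.2 h₂.symm]
    group
  have hu' : ∀ i j : ZMod n, (j = p + i ∨ i = p + j) →
      (y (q + i))⁻¹ * y (q + i + 2 * p) =
        (y j)⁻¹⁻¹ * ((y i)⁻¹ * y (i + 2 * p)) * (y j)⁻¹ := by
    intro i j h
    have h₁ := hy i j h
    have h₂ := hy (i + 2 * p) j (by grind)
    rw [← add_assoc] at h₂
    rw [eq_mul_inv_of_mul_eq h₁, eq_mul_inv_of_mul_eq h₂]
    group
  fin_cases j <;> fin_cases k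
  · change Commute ((y d)⁻¹ * y (d + 2 * p)) ((y (d + p))⁻¹ * y (d + p + 2 * p))
    simpa using (commute_of_conj_eq (hu' d (d + p) (by grind))
      (hu' d (d + p + 2 * p) (by grind))).2
  · change Commute ((y d)⁻¹ * y (d + 2 * p)) (y (d + p - q) * (y (d + p - q + 2 * p))⁻¹)
    exact (commute_of_conj_eq (hu (d + p) d (by grind)) (hu (d + p) (d + 2 * p) (by grind))).1.symm
  · change Commute (y (d - q) * (y (d - q + 2 * p))⁻¹) ((y (d + p))⁻¹ * y (d + p + 2 * p))
    exact (commute_of_conj_eq (hu d (d + p) (by grind)) (hu d (d + p + 2 * p) (by grind))).1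
  · change Commute (y (d - q) * (y (d - q + 2 * p))⁻¹)
      (y (d + p - q) * (y (d + p - q + 2 * p))⁻¹)
    exact (commute_of_conj_eq (hu (d - q) (d + p - q) (by grind))
      (hu (d - q) (d + p - q + 2 * p) (by grind))).2

/-- The pairs at `0` and at `p` generate a direct product of two free groups. -/
theorem hasSubgroupIso_prod (h4 : 4 * p = 0) (h2 : 2 * p ≠ 0) (q : ZMod n) :
    HasSubgroupIso (CyclicGroup n (word false p q (p + q))) (F 2 × F 2) := by
  let f := MonoidHom.noncommCoprod (FreeGroup.lift (pairElement p q 0))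
    (FreeGroup.lift (pairElement p q (0 + p))) (commute_lift (commute_pairElement h4 0))
  have hf : Function.Injective f := by
    rw [injective_iff_map_eq_one]
    rintro ⟨u, v⟩ h
    rw [MonoidHom.noncommCoprod_apply] at h
    have hu : u = 1 := by
      have := congrArg (fun g => twistedAction h4 h2 q 0 g (1, 0)) h
      simp only [map_mul, Equiv.Perm.mul_apply, twistedAction_lift_add, twistedAction_lift,
        map_one, Equiv.Perm.one_apply, mul_one] at this
      exact congrArg Prod.fst this
    subst hu
    have := congrArg (fun g => twistedAction h4 h2 q (0 + p) g (1, 0)) h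
    simp only [map_one, one_mul, twistedAction_lift, Equiv.Perm.one_apply, mul_one] at this
    have hv : v = 1 := congrArg Prod.fst this
    rw [hv]
    rfl
  exact ⟨f.range, ⟨(MonoidHom.ofInjective hf).symm⟩⟩

end ProductOfFreeGroups

/-! ### Twisted commutation relations on four generators -/

section FourGenerators

/-- The generators of `F_2 × F_2`, alternating between the factors. -/
def prodGen (i : ZMod 4) : F 2 × F 2 :=
  (![(genA, 1), (1, genA), (genB, 1), (1, genB)] : Fin 4 → F 2 × F 2) i

/-- The automorphism of `F_2 × F_2` that shifts the generators cyclically. -/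
def prodShift : F 2 × F 2 ≃* F 2 × F 2 :=
  MulEquiv.prodComm.trans
    ((FreeGroup.freeGroupCongr (Equiv.swap 0 1)).prodCongr (MulEquiv.refl (F 2)))

theorem prodShift_pow_prodGen :
    ∀ q i : ZMod 4, (prodShift ^ q.val) (prodGen i) = prodGen (q + i) := by
  decide

theorem prodGen_commute : ∀ i : ZMod 4, Commute (prodGen i) (prodGen (1 + i)) := by
  have h : ∀ i : ZMod 4, prodGen i * prodGen (1 + i) = prodGen (1 + i) * prodGen i := by decide
  exact h

/-- Homomorphisms from `F_2 × F_2` are determined by the images of the generators. -/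
theorem prod_hom_ext {M : Type*} [Group M] {f g : F 2 × F 2 →* M}
    (h : ∀ i, f (prodGen i) = g (prodGen i)) : f = g := by
  have h₁ : f.comp (MonoidHom.inl _ _) = g.comp (MonoidHom.inl _ _) :=
    FreeGroup.ext_hom _ _ fun i => by
      fin_cases i
      exacts [h 0, h 2]
  have h₂ : f.comp (MonoidHom.inr _ _) = g.comp (MonoidHom.inr _ _) :=
    FreeGroup.ext_hom _ _ fun i => by
      fin_cases i
      exacts [h 1, h 3]
  refine MonoidHom.ext fun z => ?_
  rw [← Prod.fst_mul_snd z, map_mul, map_mul]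
  exact congrArg₂ _ (DFunLike.congr_fun h₁ z.1) (DFunLike.congr_fun h₂ z.2)

theorem prodShift_pow_four : prodShift ^ 4 = 1 := by
  have h : (prodShift ^ 4).toMonoidHom = MonoidHom.id _ := prod_hom_ext (by decide)
  exact MulEquiv.ext fun z => DFunLike.congr_fun h z

/-- A homomorphism from `F_2 × F_2` given by the images of the generators. -/
def prodLift {M : Type*} [Group M] (f : ZMod 4 → M) (h : ∀ i, Commute (f i) (f (1 + i))) :
    F 2 × F 2 →* M :=
  MonoidHom.noncommCoprod (FreeGroup.lift ![f 0, f 2]) (FreeGroup.lift ![f 1, f 3]) <|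
    commute_lift fun i j => by
      fin_cases i <;> fin_cases j
      exacts [h 0, (h 3).symm, (h 1).symm, h 2]

theorem prodLift_prodGen {M : Type*} [Group M] (f : ZMod 4 → M)
    (h : ∀ i, Commute (f i) (f (1 + i))) (i : ZMod 4) : prodLift f h (prodGen i) = f i := by
  fin_cases i <;> simp [prodLift, prodGen] <;> rfl

/-- For `q = 0` the relators say that cyclically adjacent generators commute. -/
theorem nonempty_mulEquiv_prod :
    Nonempty (CyclicGroup 4 (word false 1 0 (1 + 0)) ≃* F 2 × F 2) := by
  let f : CyclicGroup 4 (word false 1 0 (1 + 0)) →* F 2 × F 2 :=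
    cyclicLift prodGen <| lift_map_word_eq_one fun i => by
      rw [zero_add, add_zero]
      exact prodGen_commute i
  let f' : F 2 × F 2 →* CyclicGroup 4 (word false 1 0 (1 + 0)) :=
    prodLift PresentedGroup.of fun i => by
      have := twisted_commutation (n := 4) 1 0 i
      rw [zero_add, add_zero] at this
      exact this
  refine ⟨f.toMulEquiv f' (PresentedGroup.ext fun i => ?_) (prod_hom_ext fun i => ?_)⟩
  · exact (congrArg f' (cyclicLift_of _ _ i)).trans (prodLift_prodGen _ _ i)
  · exact (congrArg f (prodLift_prodGen _ _ i)).trans (cyclicLift_of _ _ i)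

variable (q : ZMod 4)

/-- The group given by the relators `x_i x_{1+i}⁻¹ x_{q+i}⁻¹ x_{1+q+i}`. -/
abbrev TwistedGroup : Type := CyclicGroup 4 (word false 1 q (1 + q))

/-- The action of `TwistedGroup q` on the set `F_2 × F_2`, in which `x_i` acts as a left
multiplication followed by the shift by `q`. -/
def prodAction : TwistedGroup q →* Equiv.Perm (F 2 × F 2) :=
  cyclicLift (fun i => (prodShift ^ q.val).toEquiv * Equiv.mulLeft (prodGen i)) <|
    lift_map_word_eq_one fun i => by
      ext1 z
      simp only [Equiv.Perm.mul_apply, Equiv.coe_mulLeft, MulEquiv.toEquiv_eq_coe,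
        MulEquiv.coe_toEquiv, map_mul, prodShift_pow_prodGen]
      rw [← mul_assoc, ← mul_assoc, show q + (q + (1 + i)) = 1 + (q + (q + i)) by ring,
        show q + (1 + q + i) = 1 + (q + (q + i)) by ring, (prodGen_commute _).eq]

/-- The shift by `q` as an automorphism of `TwistedGroup q`. -/
def groupShift : TwistedGroup q ≃* TwistedGroup q :=
  have key : ∀ c i : ZMod 4, FreeGroup.lift
      (fun j => (PresentedGroup.of (c + j) : TwistedGroup q))
        (FreeGroup.map (· + i) (word false 1 q (1 + q))) = 1 := fun c =>
    lift_map_word_eq_one fun i => by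
      have := twisted_commutation (n := 4) 1 q (c + i)
      rwa [add_left_comm q, add_left_comm 1, add_left_comm (1 + q)] at this
  (cyclicLift _ (key q)).toMulEquiv (cyclicLift _ (key (-q)))
    (PresentedGroup.ext fun i => by simp) (PresentedGroup.ext fun i => by simp)

theorem groupShift_of (i : ZMod 4) :
    groupShift q (PresentedGroup.of i) = PresentedGroup.of (q + i) := by
  simp [groupShift]

theorem prodAction_of (i : ZMod 4) (z : F 2 × F 2) :
    prodAction q (PresentedGroup.of i) z = (prodShift ^ q.val) (prodGen i * z) := by
  rw [prodAction, cyclicLift_of]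
  rfl

/-- The extension of `TwistedGroup q` by its shift automorphism `τ`. -/
abbrev ShiftExtension : Type :=
  TwistedGroup q ⋊[zpowersHom (MulAut (TwistedGroup q)) (groupShift q)] Multiplicative ℤ

/-- The shift automorphism as an element `τ` of the extension. -/
def tau : ShiftExtension q := SemidirectProduct.inr (Multiplicative.ofAdd 1)

theorem inl_mul_tau_inv (g : TwistedGroup q) :
    SemidirectProduct.inl g * (tau q)⁻¹ = (tau q)⁻¹ * SemidirectProduct.inl (groupShift q g) := by
  have : (SemidirectProduct.inl (groupShift q g) : ShiftExtension q) =
      tau q * SemidirectProduct.inl g * (tau q)⁻¹ := by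
    have := SemidirectProduct.inl_aut (φ := zpowersHom (MulAut (TwistedGroup q)) (groupShift q))
      (Multiplicative.ofAdd 1) g
    rw [zpowersHom_apply, toAdd_ofAdd, zpow_one] at this
    exact this
  rw [this]
  group

/-- The element `τ⁻¹ x_i` of the extension. In terms of these the relators of `TwistedGroup q` say
that cyclically adjacent elements commute. -/
def untwistedGen (i : ZMod 4) : ShiftExtension q :=
  (tau q)⁻¹ * SemidirectProduct.inl (PresentedGroup.of i)

theorem untwistedGen_mul (i j : ZMod 4) : untwistedGen q i * untwistedGen q j =
    (tau q)⁻¹ * (tau q)⁻¹ *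
      SemidirectProduct.inl (PresentedGroup.of (q + i) * PresentedGroup.of j) := by
  rw [untwistedGen, untwistedGen, mul_assoc, ← mul_assoc (SemidirectProduct.inl _),
    inl_mul_tau_inv, groupShift_of, map_mul]
  simp only [mul_assoc]

/-- The homomorphism from `F_2 × F_2` to the extension given by the elements `τ⁻¹ x_i`. -/
def untwist : F 2 × F 2 →* ShiftExtension q :=
  prodLift (untwistedGen q) fun i => by
    change _ * _ = _ * _
    rw [untwistedGen_mul, untwistedGen_mul, twisted_commutation]
    rw [show q + (1 + i) = 1 + q + i by ring]

theorem map_zpow_apply {G H : Type*} [Group G] [Group H] (A : G →* H) (θ : MulAut G) (s : H)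
    (h : ∀ g, A (θ g) = s * A g * s⁻¹) (k : ℤ) (g : G) :
    A ((θ ^ k) g) = s ^ k * A g * (s ^ k)⁻¹ := by
  induction k generalizing g with
  | zero => simp
  | succ k ih =>
    rw [zpow_add_one, MulAut.mul_apply, ih, h, zpow_add_one]
    group
  | pred k ih =>
    have h' : A (θ⁻¹ g) = s⁻¹ * A g * s := by
      have := h (θ⁻¹ g)
      rw [MulAut.apply_inv_self] at this
      rw [this]
      group
    rw [zpow_sub_one, MulAut.mul_apply, ih, h', zpow_sub_one]
    group

/-- The extension acts on `F_2 × F_2`, `τ` acting as the shift by `q`. -/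
def extensionAction : ShiftExtension q →* Equiv.Perm (F 2 × F 2) :=
  SemidirectProduct.lift (prodAction q)
    (zpowersHom (Equiv.Perm (F 2 × F 2)) (prodShift ^ q.val).toEquiv) fun e => by
    have h : ∀ g, prodAction q (groupShift q g) =
        (prodShift ^ q.val).toEquiv * prodAction q g * ((prodShift ^ q.val).toEquiv)⁻¹ := by
      intro g
      have : (prodAction q).comp (groupShift q).toMonoidHom =
          (MulAut.conj (prodShift ^ q.val).toEquiv).toMonoidHom.comp (prodAction q) := by
        refine PresentedGroup.ext fun i => ?_
        ext1 z
        change prodAction q (groupShift q (PresentedGroup.of i)) z = (prodShift ^ q.val)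
          (prodAction q (PresentedGroup.of i) ((prodShift ^ q.val).symm z))
        rw [groupShift_of, prodAction_of, prodAction_of, map_mul (prodShift ^ q.val) (prodGen i),
          prodShift_pow_prodGen, MulEquiv.apply_symm_apply]
      exact DFunLike.congr_fun this g
    refine MonoidHom.ext fun g => ?_
    exact map_zpow_apply (prodAction q) (groupShift q) _ h e.toAdd g

theorem extensionAction_untwist (γ z : F 2 × F 2) :
    extensionAction q (untwist q γ) z = γ * z := by
  have : (extensionAction q).comp (untwist q) = MulAction.toPermHom (F 2 × F 2) (F 2 × F 2) := by
    refine prod_hom_ext fun i => ?_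
    rw [MonoidHom.comp_apply, untwist, prodLift_prodGen, untwistedGen, map_mul, map_inv,
      extensionAction, SemidirectProduct.lift_inl, tau, SemidirectProduct.lift_inr,
      inv_mul_eq_iff_eq_mul]
    ext1 z
    rw [prodAction_of, zpowersHom_apply, toAdd_ofAdd, zpow_one]
    rfl
  exact DFunLike.congr_fun (DFunLike.congr_fun this γ) z

theorem prodAction_untwist_left (γ z : F 2 × F 2) :
    prodAction q (untwist q γ).left
      (((prodShift ^ q.val).toEquiv ^ (untwist q γ).right.toAdd : Equiv.Perm (F 2 × F 2)) z) =
      γ * z :=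
  extensionAction_untwist q γ z

theorem prodAction_transitive (γ : F 2 × F 2) : ∃ g, prodAction q g 1 = γ := by
  refine ⟨(untwist q γ).left, ?_⟩
  have h : ∀ k : ℤ, ((prodShift ^ q.val).toEquiv ^ k : Equiv.Perm (F 2 × F 2)) 1 = 1 := by
    intro k
    have h1 : (prodShift ^ q.val).toEquiv 1 = 1 := map_one (prodShift ^ q.val)
    exact Function.IsFixedPt.perm_zpow h1 k
  have := prodAction_untwist_left q γ 1
  rwa [h, mul_one] at this

/-- Equivariance of the map that takes `γ` to the component in `TwistedGroup q` of its image in the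
extension. -/
theorem untwist_prodAction (g : TwistedGroup q) (γ : F 2 × F 2) :
    (untwist q (prodAction q g γ)).left = g * (untwist q γ).left := by
  have hshift : ∀ γ, untwist q ((prodShift ^ q.val) γ) = tau q * untwist q γ * (tau q)⁻¹ := by
    intro γ
    have : (untwist q).comp (prodShift ^ q.val).toMonoidHom =
        (MulAut.conj (tau q)).toMonoidHom.comp (untwist q) := by
      refine prod_hom_ext fun i => ?_
      change untwist q ((prodShift ^ q.val) (prodGen i)) =
        tau q * untwist q (prodGen i) * (tau q)⁻¹
      rw [prodShift_pow_prodGen, untwist, prodLift_prodGen, prodLift_prodGen, untwistedGen,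
        untwistedGen, mul_inv_cancel_left, inl_mul_tau_inv, groupShift_of]
    exact DFunLike.congr_fun this γ
  have hgen : ∀ (i : ZMod 4) γ, (untwist q (prodAction q (PresentedGroup.of i) γ)).left =
      PresentedGroup.of i * (untwist q γ).left := by
    intro i γ
    have hi : untwist q (prodGen i) = untwistedGen q i := prodLift_prodGen _ _ i
    rw [prodAction_of, hshift, map_mul, hi, untwistedGen, mul_assoc (tau q)⁻¹, mul_inv_cancel_left]
    simp [tau, ← map_inv]
  induction g using cyclicGroup_induction with
  | one => simp
  | of_mul i g ih => rw [map_mul, Equiv.Perm.mul_apply, hgen, ih, mul_assoc]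
  | of_inv_mul i g ih =>
    have h := hgen i (prodAction q ((PresentedGroup.of i)⁻¹ * g) γ)
    rw [← Equiv.Perm.mul_apply, ← map_mul, mul_inv_cancel_left, ih] at h
    rw [mul_assoc, h, inv_mul_cancel_left]

/-- By equivariance, `g` is determined by `prodAction q g 1`. -/
theorem prodAction_free (g : TwistedGroup q) (h : prodAction q g 1 = 1) : g = 1 := by
  have := untwist_prodAction q g 1
  rw [h] at this
  exact (mul_eq_right.1 this.symm)

/-- The power of `τ` in the image of `(u, v)` is minus the sum of the exponent sums. -/
theorem untwist_right {m : ℕ} {u v : F 2} (hu : u ∈ (expSum m).ker) (hv : v ∈ (expSum m).ker) :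
    (m : ℤ) ∣ (untwist q (u, v)).right.toAdd := by
  have : ((Int.castAddHom (ZMod m)).toMultiplicative.comp SemidirectProduct.rightHom).comp
      (untwist q) = ((expSum m).coprod (expSum m))⁻¹ := by
    refine prod_hom_ext fun i => ?_
    rw [MonoidHom.comp_apply, untwist, prodLift_prodGen]
    fin_cases i <;> simp [untwistedGen, tau, prodGen, expSum]
  have := DFunLike.congr_fun this (u, v)
  rw [MonoidHom.inv_apply, MonoidHom.coprod_apply, hu, hv, mul_one, inv_one] at this
  exact (ZMod.intCast_zmod_eq_zero_iff_dvd _ _).1 this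

/-- Subgroups of `F_2 × F_2` on which the twist is trivial are also subgroups of `TwistedGroup q`,
of the same index. -/
theorem exists_subgroup_twistedGroup {m : ℕ} (hm : q.val * m = 4) {K₁ K₂ : Subgroup (F 2)}
    (h₁ : K₁ ≤ (expSum m).ker) (h₂ : K₂ ≤ (expSum m).ker) :
    ∃ S : Subgroup (TwistedGroup q), S.index = K₁.index * K₂.index ∧
      Nonempty (S ≃* K₁ × K₂) := by
  have hK : ∀ k ∈ K₁.prod K₂, ∃ g, ∀ γ, prodAction q g γ = k * γ := by
    rintro ⟨u, v⟩ ⟨hu, hv⟩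
    refine ⟨(untwist q (u, v)).left, fun γ => ?_⟩
    obtain ⟨c, hc⟩ := untwist_right q (h₁ hu) (h₂ hv)
    have h1 : (prodShift ^ q.val).toEquiv ^ (untwist q (u, v)).right.toAdd = 1 := by
      have h4 : (prodShift ^ q.val).toEquiv ^ m = 1 := by
        have : (prodShift ^ q.val) ^ m = 1 := by rw [← pow_mul, hm, prodShift_pow_four]
        change MulAut.toPerm _ (prodShift ^ q.val) ^ m = 1
        rw [← map_pow, this, map_one]
      rw [hc, zpow_mul, zpow_natCast, h4, one_zpow]
    have := prodAction_untwist_left q (u, v) γ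
    rwa [h1] at this
  obtain ⟨e⟩ := nonempty_translationSubgroup_mulEquiv (prodAction_free q) hK
  exact ⟨_, (index_translationSubgroup (prodAction_free q) (prodAction_transitive q) hK).trans
    (Subgroup.index_prod _ _), ⟨e.trans (Subgroup.prodEquiv _ _)⟩⟩

theorem hasSubgroupIsoOfIndex_one : HasSubgroupIsoOfIndex (TwistedGroup 1) (F 5 × F 5) 16 := by
  obtain ⟨S, hS, ⟨e⟩⟩ := exists_subgroup_twistedGroup 1 (m := 4) rfl le_rfl le_rfl
  obtain ⟨e₄⟩ := schreierFour.nonempty_ker_mulEquiv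
  exact ⟨S, by rw [hS, index_ker_expSum], ⟨e.trans (e₄.prodCongr e₄)⟩⟩

theorem hasSubgroupIsoOfIndex_two : HasSubgroupIsoOfIndex (TwistedGroup 2) (F 3 × F 5) 8 := by
  have hle : (expSum 4).ker ≤ (expSum 2).ker := by
    have : expSum 2 = (ZMod.castHom (by norm_num : 2 ∣ 4)
        (ZMod 2)).toAddMonoidHom.toMultiplicative.comp (expSum 4) := by
      ext i
      simp [expSum]
    intro k hk
    rw [MonoidHom.mem_ker] at hk ⊢
    rw [this, MonoidHom.comp_apply, hk, map_one]
  obtain ⟨S, hS, ⟨e⟩⟩ := exists_subgroup_twistedGroup 2 (m := 2) rfl le_rfl hle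
  obtain ⟨e₂⟩ := schreierTwo.nonempty_ker_mulEquiv
  obtain ⟨e₄⟩ := schreierFour.nonempty_ker_mulEquiv
  exact ⟨S, by rw [hS, index_ker_expSum, index_ker_expSum], ⟨e.trans (e₂.prodCongr e₄)⟩⟩

end FourGenerators

/-! ### Square relations on four generators -/

section NormalForm

variable {G : Type*} [Group G] {ι₁ ι₂ : F 2 →* G} {A B : G →* Equiv.Perm (F 2)}

/-- If letters of the second free group can be moved to the right past letters of the first, at the
cost of replacing both, then they can be moved past words. -/
theorem exists_mul_eq_of_exchange {X : Type*} {ι : FreeGroup X →* G} {Y : Set G}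
    (h : ∀ y ∈ Y, ∀ j, (∃ y' ∈ Y, ∃ u, y * ι (FreeGroup.of j) = ι u * y') ∧
      ∃ y' ∈ Y, ∃ u, y * (ι (FreeGroup.of j))⁻¹ = ι u * y') {y : G} (hy : y ∈ Y)
    (v : FreeGroup X) : ∃ y' ∈ Y, ∃ u, y * ι v = ι u * y' := by
  induction v using freeGroup_induction_left generalizing y with
  | one => exact ⟨y, hy, 1, by simp⟩
  | of_mul j v ih =>
    obtain ⟨y', hy', u, hu⟩ := (h y hy j).1
    obtain ⟨y'', hy'', u', hu'⟩ := ih hy'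
    refine ⟨y'', hy'', u * u', ?_⟩
    rw [map_mul, ← mul_assoc, hu, mul_assoc, hu', map_mul, mul_assoc]
  | of_inv_mul j v ih =>
    obtain ⟨y', hy', u, hu⟩ := (h y hy j).2
    obtain ⟨y'', hy'', u', hu'⟩ := ih hy'
    refine ⟨y'', hy'', u * u', ?_⟩
    rw [map_mul, map_inv, ← mul_assoc, hu, mul_assoc, hu', map_mul, mul_assoc]

/-- Suppose that each element of `G` is the product of an element of `ι₁ (F_2)` and one of
`ι₂ (F_2)`, and that `G` acts on two copies of `F_2` such that each of the two free groups acts on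
one of them by left multiplications and fixes `1` in the other. Then `G` acts simply transitively on
the product, and if `K` acts trivially where it fixes `1`, then the left multiplications by elements
of `K × K` are realized in `G`. -/
theorem exists_subgroup_of_normalForm (hA₁ : ∀ u v, A (ι₁ u) v = u * v)
    (hA₂ : ∀ u, A (ι₂ u) 1 = 1) (hB₂ : ∀ u v, B (ι₂ u) v = u * v)
    (hmul : ∀ g, ∃ u v, g = ι₁ u * ι₂ v) {K : Subgroup (F 2)}
    (hK : ∀ k ∈ K, A (ι₂ k) = 1 ∧ B (ι₁ k) = 1) :
    ∃ S : Subgroup G, S.index = K.index * K.index ∧ Nonempty (S ≃* K × K) ∧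
      ∀ g ∈ S, ∃ u ∈ K, ∃ v ∈ K, g = ι₁ u * ι₂ v := by
  let D : G →* Equiv.Perm (F 2 × F 2) :=
    { toFun := fun g => (A g).prodCongr (B g)
      map_one' := by ext1 z; simp
      map_mul' := fun g h => by ext1 z; simp [Prod.map] }
  have hD : ∀ g z, D g z = (A g z.1, B g z.2) := fun _ _ => rfl
  have hfree : ∀ g, D g 1 = 1 → g = 1 := by
    intro g hg
    obtain ⟨u, v, rfl⟩ := hmul g
    rw [hD, Prod.mk_eq_one, Prod.fst_one, Prod.snd_one, map_mul, map_mul, Equiv.Perm.mul_apply,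
      Equiv.Perm.mul_apply, hA₂, hA₁, mul_one, hB₂, mul_one] at hg
    obtain ⟨rfl, hv⟩ := hg
    rw [map_one, map_one, Equiv.Perm.one_apply] at hv
    rw [hv, map_one, map_one, mul_one]
  have htrans : ∀ γ, ∃ g, D g 1 = γ := by
    rintro ⟨u, v⟩
    refine ⟨ι₁ u * ι₂ ((B (ι₁ u))⁻¹ v), ?_⟩
    rw [hD, Prod.fst_one, Prod.snd_one, map_mul, map_mul, Equiv.Perm.mul_apply,
      Equiv.Perm.mul_apply, hA₂, hA₁, mul_one, hB₂, mul_one, ← Equiv.Perm.mul_apply, mul_inv_cancel,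
      Equiv.Perm.one_apply]
  have hact : ∀ u ∈ K, ∀ v ∈ K, ∀ γ, D (ι₁ u * ι₂ v) γ = (u, v) * γ := by
    intro u hu v hv γ
    rw [hD, map_mul, map_mul, (hK v hv).1, (hK u hu).2, mul_one, one_mul, hA₁, hB₂]
    rfl
  have hprod : ∀ k ∈ K.prod K, ∃ g, ∀ γ, D g γ = k * γ := by
    rintro ⟨u, v⟩ ⟨hu, hv⟩
    exact ⟨_, hact u hu v hv⟩
  obtain ⟨e⟩ := nonempty_translationSubgroup_mulEquiv hfree hprod
  refine ⟨_, (index_translationSubgroup hfree htrans hprod).trans (Subgroup.index_prod _ _),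
    ⟨e.trans (Subgroup.prodEquiv _ _)⟩, fun g hg => ?_⟩
  obtain ⟨⟨u, v⟩, ⟨hu, hv⟩, h⟩ := mem_translationSubgroup.1 hg
  refine ⟨u, hu, v, hv, eq_of_map_one_eq hfree ?_⟩
  rw [h, hact u hu v hv]

end NormalForm

section Squares

variable (r : ZMod 4)

/-- The group given by the relators `x_i x_{1+i}⁻¹ x_i x_{r+i}`. -/
abbrev SquareGroup : Type := CyclicGroup 4 (word true 1 0 r)

variable {r}

theorem square_relation (i : ZMod 4) :
    (PresentedGroup.of i * (PresentedGroup.of (1 + i))⁻¹ * PresentedGroup.of i *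
      PresentedGroup.of (r + i) : SquareGroup r) = 1 := by
  have := relation true 1 0 r i
  rwa [zero_add] at this

theorem exchanges_of_mul_eq_one {G : Type*} [Group G] {a b c d : G} (h : a * b * c * d = 1) :
    a * b = d⁻¹ * c⁻¹ ∧ c * d = b⁻¹ * a⁻¹ ∧ a⁻¹ * d⁻¹ = b * c ∧ c⁻¹ * b⁻¹ = d * a := by
  have h' : a = d⁻¹ * c⁻¹ * b⁻¹ := by
    rw [eq_mul_inv_iff_mul_eq, eq_mul_inv_iff_mul_eq, ← mul_eq_one_iff_eq_inv, h]
  subst h'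
  refine ⟨?_, ?_, ?_, ?_⟩ <;> group

/-- The generators with even subscripts and their inverses. -/
def evenLetters (r : ZMod 4) : Set (SquareGroup r) :=
  {g | ∃ i : ZMod 4, (i = 0 ∨ i = 2) ∧ (g = PresentedGroup.of i ∨ g = (PresentedGroup.of i)⁻¹)}

/-- The homomorphism from the free group on `a, b` with `a ↦ x_i` and `b ↦ x_{i+2}^ε`. -/
def pairHom (r : ZMod 4) (ε : ℤ) (i : ZMod 4) : F 2 →* SquareGroup r :=
  FreeGroup.lift ![PresentedGroup.of i, PresentedGroup.of (i + 2) ^ ε]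

/-- Each corner of a relator, read as a square with alternately even and odd sides, allows to
exchange an even letter with the odd letter that follows it; the sixteen corners are all
different. -/
theorem exists_exchange (hr : r = 1 ∨ r = 3) {W : Subgroup (SquareGroup r)}
    (hW : ∀ j : ZMod 4, j = 1 ∨ j = 3 → PresentedGroup.of j ∈ W) {y : SquareGroup r}
    (hy : y ∈ evenLetters r) {j : ZMod 4} (hj : j = 1 ∨ j = 3) :
    (∃ y' ∈ evenLetters r, ∃ z ∈ W, y * PresentedGroup.of j = z * y') ∧
    ∃ y' ∈ evenLetters r, ∃ z ∈ W, y * (PresentedGroup.of j)⁻¹ = z * y' := by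
  obtain ⟨i, hi, hy⟩ := hy
  have mem : ∀ k : ZMod 4, k = 0 ∨ k = 2 → PresentedGroup.of k ∈ evenLetters r ∧
      (PresentedGroup.of k)⁻¹ ∈ evenLetters r := fun k hk =>
    ⟨⟨k, hk, Or.inl rfl⟩, ⟨k, hk, Or.inr rfl⟩⟩
  have hij : j = 1 + i ∨ i = 1 + j := by
    rcases hi with rfl | rfl <;> rcases hj with rfl | rfl <;> decide
  have hij' : j = r + i ∨ i = r + j := by
    rcases hr with rfl | rfl <;> rcases hi with rfl | rfl <;> rcases hj with rfl | rfl <;> decide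
  obtain ⟨e₁, e₂, e₃, e₄⟩ := exchanges_of_mul_eq_one (square_relation (r := r) i)
  obtain ⟨o₁, o₂, o₃, o₄⟩ := exchanges_of_mul_eq_one (square_relation (r := r) j)
  have h1i : 1 + i = 1 ∨ 1 + i = 3 := by rcases hi with rfl | rfl <;> decide
  have hri : r + i = 1 ∨ r + i = 3 := by
    rcases hr with rfl | rfl <;> rcases hi with rfl | rfl <;> decide
  have h1j : 1 + j = 0 ∨ 1 + j = 2 := by rcases hj with rfl | rfl <;> decide
  have hrj : r + j = 0 ∨ r + j = 2 := by
    rcases hr with rfl | rfl <;> rcases hj with rfl | rfl <;> decide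
  rw [inv_inv] at e₂ e₄ o₂ o₄
  rcases hy with rfl | rfl
  · constructor
    · rcases hij' with h | h
      · exact ⟨_, (mem i hi).2, _, hW _ h1i, by rw [h, e₂]⟩
      · exact ⟨_, (mem _ h1j).1, _, inv_mem (hW _ hj), by rw [h]; exact o₄.symm⟩
    · rcases hij with h | h
      · exact ⟨_, (mem i hi).2, _, inv_mem (hW _ hri), by rw [h, e₁]⟩
      · exact ⟨_, (mem _ hrj).1, _, hW _ hj, by rw [h]; exact o₂.symm⟩
  · constructor
    · rcases hij with h | h
      · exact ⟨_, (mem i hi).1, _, hW _ hri, by rw [h, e₄]⟩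
      · exact ⟨_, (mem _ hrj).2, _, inv_mem (hW _ hj), by rw [h]; exact o₃.symm⟩
    · rcases hij' with h | h
      · exact ⟨_, (mem i hi).1, _, inv_mem (hW _ h1i), by rw [h, e₃]⟩
      · exact ⟨_, (mem _ h1j).2, _, hW _ hj, by rw [h]; exact o₁.symm⟩

theorem of_mem_range_pairHom {ε : ℤ} (hε : ε = 1 ∨ ε = -1) (i : ZMod 4) :
    PresentedGroup.of i ∈ (pairHom r ε i).range ∧
      PresentedGroup.of (i + 2) ∈ (pairHom r ε i).range := by
  refine ⟨⟨genA, by simp [pairHom]⟩, ⟨genB ^ ε, ?_⟩⟩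
  rcases hε with rfl | rfl <;> simp [pairHom]

theorem exists_eq_pairHom_mul (hr : r = 1 ∨ r = 3) {ε : ℤ} (hε : ε = 1 ∨ ε = -1)
    (g : SquareGroup r) : ∃ u v, g = pairHom r ε 1 u * pairHom r ε 0 v := by
  have hodd : ∀ j : ZMod 4, j = 1 ∨ j = 3 → PresentedGroup.of j ∈ (pairHom r ε 1).range := by
    rintro j (rfl | rfl)
    exacts [(of_mem_range_pairHom hε 1).1, (of_mem_range_pairHom hε 1).2]
  have heven : ∀ y ∈ evenLetters r, y ∈ (pairHom r ε 0).range := by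
    rintro y ⟨i, rfl | rfl, rfl | rfl⟩
    exacts [(of_mem_range_pairHom hε 0).1, inv_mem (of_mem_range_pairHom hε 0).1,
      (of_mem_range_pairHom hε 0).2, inv_mem (of_mem_range_pairHom hε 0).2]
  have hmul : ∀ y ∈ evenLetters r, ∀ v, ∃ y' ∈ evenLetters r, ∃ u,
      y * pairHom r ε 1 v = pairHom r ε 1 u * y' := by
    intro y hy v
    have e₁₂ : (1 + 2 : ZMod 4) = 3 := rfl
    refine exists_mul_eq_of_exchange (fun y hy j => ?_) hy v
    have h₁ := exists_exchange hr hodd hy (j := 1) (Or.inl rfl)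
    have h₃ := exists_exchange hr hodd hy (j := 3) (Or.inr rfl)
    have h' : ∀ g g' : SquareGroup r,
        ((∃ y' ∈ evenLetters r, ∃ z ∈ (pairHom r ε 1).range, y * g = z * y') ∧
          ∃ y' ∈ evenLetters r, ∃ z ∈ (pairHom r ε 1).range, y * g' = z * y') →
        (∃ y' ∈ evenLetters r, ∃ u, y * g = pairHom r ε 1 u * y') ∧
          ∃ y' ∈ evenLetters r, ∃ u, y * g' = pairHom r ε 1 u * y' := by
      rintro g g' ⟨⟨y', hy', _, ⟨u, rfl⟩, h⟩, ⟨y'', hy'', _, ⟨u', rfl⟩, h'⟩⟩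
      exact ⟨⟨y', hy', u, h⟩, ⟨y'', hy'', u', h'⟩⟩
    fin_cases j
    · simpa [pairHom] using h' _ _ h₁
    · rcases hε with rfl | rfl
      · simpa [pairHom, e₁₂] using h' _ _ h₃
      · simpa [pairHom, e₁₂] using h' _ _ h₃.symm
  -- Multiplication from the left by even letters preserves the set of products.
  have hleft : ∀ y ∈ evenLetters r, ∀ g : SquareGroup r,
      (∃ u v, g = pairHom r ε 1 u * pairHom r ε 0 v) →
        ∃ u v, y * g = pairHom r ε 1 u * pairHom r ε 0 v := by
    rintro y hy g ⟨u, v, rfl⟩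
    obtain ⟨y', hy', u', h⟩ := hmul y hy u
    obtain ⟨v', hv'⟩ := heven y' hy'
    exact ⟨u', v' * v, by rw [← mul_assoc, h, map_mul, hv', mul_assoc]⟩
  have hleft' : ∀ z ∈ (pairHom r ε 1).range, ∀ g : SquareGroup r,
      (∃ u v, g = pairHom r ε 1 u * pairHom r ε 0 v) →
        ∃ u v, z * g = pairHom r ε 1 u * pairHom r ε 0 v := by
    rintro _ ⟨u', rfl⟩ g ⟨u, v, rfl⟩
    exact ⟨u' * u, v, by rw [map_mul, mul_assoc]⟩
  have hparity : ∀ i : ZMod 4, (i = 0 ∨ i = 2) ∨ (i = 1 ∨ i = 3) := by decide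
  induction g using cyclicGroup_induction with
  | one => exact ⟨1, 1, by simp⟩
  | of_mul i g ih =>
    rcases hparity i with hi | hi
    · exact hleft _ ⟨i, hi, Or.inl rfl⟩ g ih
    · exact hleft' _ (hodd i hi) g ih
  | of_inv_mul i g ih =>
    rcases hparity i with hi | hi
    · exact hleft _ ⟨i, hi, Or.inr rfl⟩ g ih
    · exact hleft' _ (inv_mem (hodd i hi)) g ih

/-- The conclusion of `exists_subgroup_of_normalForm` for `SquareGroup r`, where one action on `F_2`
is given by permutations `f i` for the generators `x_i`, and the other one is its composition with
the shift. -/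
theorem exists_subgroup_squareGroup (hr : r = 1 ∨ r = 3) {ε : ℤ} (hε : ε = 1 ∨ ε = -1)
    (f : ZMod 4 → Equiv.Perm (F 2)) (h₀ : f 0 1 = 1) (h₁ : f 1 = Equiv.mulLeft genA)
    (h₂ : f 2 1 = 1) (h₃ : f 3 ^ ε = Equiv.mulLeft genB)
    (hrel : ∀ i, f i * (f (1 + i))⁻¹ * f i * f (r + i) = 1) {K : Subgroup (F 2)}
    (hK : ∀ k ∈ K, FreeGroup.lift ![f 0, f 2 ^ ε] k = 1 ∧ FreeGroup.lift ![f 2, f 0 ^ ε] k = 1) :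
    ∃ S : Subgroup (SquareGroup r), S.index = K.index * K.index ∧ Nonempty (S ≃* K × K) ∧
      ∀ g ∈ S, ∃ u ∈ K, ∃ v ∈ K, g = pairHom r ε 1 u * pairHom r ε 0 v := by
  let A : SquareGroup r →* Equiv.Perm (F 2) := cyclicLift f fun i => by
    rw [lift_map_word, zero_add]
    exact hrel i
  let B : SquareGroup r →* Equiv.Perm (F 2) := cyclicLift (fun i => f (i + 1)) fun i => by
    rw [lift_map_word, zero_add, add_assoc, add_assoc]
    exact hrel (i + 1)
  have hε' : ∀ s : Equiv.Perm (F 2), s 1 = 1 → (s ^ ε) 1 = 1 := fun s hs =>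
    Function.IsFixedPt.perm_zpow hs ε
  have hfix : ∀ s t : Equiv.Perm (F 2), s 1 = 1 → t 1 = 1 →
      ∀ u, FreeGroup.lift ![s, t] u 1 = 1 := by
    intro s t hs ht u
    have : (FreeGroup.lift ![s, t]).range ≤ MulAction.stabilizer (Equiv.Perm (F 2)) (1 : F 2) := by
      refine FreeGroup.range_lift_le ?_
      rintro _ ⟨i, rfl⟩
      fin_cases i
      exacts [hs, ht]
    exact this ⟨u, rfl⟩
  have hleft : ∀ u v, FreeGroup.lift ![Equiv.mulLeft genA, Equiv.mulLeft genB] u v = u * v := by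
    have : FreeGroup.lift ![Equiv.mulLeft genA, Equiv.mulLeft genB] =
        MulAction.toPermHom (F 2) (F 2) := by
      refine FreeGroup.ext_hom _ _ fun i => ?_
      fin_cases i <;> · ext1 v; simp
    intro u v
    rw [this]
    rfl
  have e₁₂ : (1 + 2 : ZMod 4) = 3 := rfl
  have hA₁ : A.comp (pairHom r ε 1) = FreeGroup.lift ![Equiv.mulLeft genA, Equiv.mulLeft genB] := by
    refine FreeGroup.ext_hom _ _ fun i => ?_
    fin_cases i
    · simp [A, pairHom, h₁]
    · simpa [A, pairHom, e₁₂] using h₃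
  have hB₂ : B.comp (pairHom r ε 0) = FreeGroup.lift ![Equiv.mulLeft genA, Equiv.mulLeft genB] := by
    refine FreeGroup.ext_hom _ _ fun i => ?_
    fin_cases i
    · simp [B, pairHom, h₁]
    · simpa [B, pairHom, add_comm, e₁₂] using h₃
  have hA₂ : A.comp (pairHom r ε 0) = FreeGroup.lift ![f 0, f 2 ^ ε] := by
    refine FreeGroup.ext_hom _ _ fun i => ?_
    fin_cases i <;> simp [A, pairHom]
  have hB₁ : B.comp (pairHom r ε 1) = FreeGroup.lift ![f 2, f 0 ^ ε] := by
    refine FreeGroup.ext_hom _ _ fun i => ?_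
    fin_cases i
    · simp [B, pairHom, one_add_one_eq_two]
    · simp [B, pairHom]
      rfl
  refine exists_subgroup_of_normalForm (A := A) (B := B) (fun u v => ?_) (fun u => ?_)
    (fun u v => ?_) (exists_eq_pairHom_mul hr hε) fun k hk => ⟨?_, ?_⟩
  · rw [← MonoidHom.comp_apply A, hA₁, hleft]
  · rw [← MonoidHom.comp_apply A, hA₂, hfix _ _ h₀ (hε' _ h₂)]
  · rw [← MonoidHom.comp_apply B, hB₂, hleft]
  · rw [← MonoidHom.comp_apply A, hA₂, (hK k hk).1]
  · rw [← MonoidHom.comp_apply B, hB₁, (hK k hk).2]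

/-- The square of a generator of the group with relations `x_i x_{i+1} = x_{i+1} x_i⁻¹` is a
commutator. -/
theorem of_sq_mem_commutator (i : ZMod 4) :
    (PresentedGroup.of i : SquareGroup 1) ^ 2 ∈ commutator (SquareGroup 1) := by
  rw [← Abelianization.ker_of, MonoidHom.mem_ker, map_pow]
  have := congrArg Abelianization.of (square_relation (r := 1) i)
  rw [map_mul, map_mul, map_mul, map_inv, map_one, mul_right_comm,
    inv_mul_cancel_right, ← pow_two] at this
  exact this

/-- An automorphism of the free group on `a, b` that is its own inverse, given by the images of
the generators. -/
def involution (e : Fin 2 → F 2) (he : ∀ i, FreeGroup.lift e (e i) = FreeGroup.of i) : F 2 ≃* F 2 :=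
  (FreeGroup.lift e).toMulEquiv (FreeGroup.lift e) (by ext i; simp [he]) (by ext i; simp [he])

/-- The action of the generators of `SquareGroup 1` on `F_2`: those with odd subscript act by left
multiplication, and each with even subscript inverts one of `a, b`. -/
def signAction : ZMod 4 → Equiv.Perm (F 2) :=
  (![(involution ![genA, genB⁻¹] (by decide)).toEquiv, Equiv.mulLeft genA,
    (involution ![genA⁻¹, genB] (by decide)).toEquiv, Equiv.mulLeft genB] :
      Fin 4 → Equiv.Perm (F 2))

/-- The elements of `parities.ker` in either half die in the abelianization, where generators square
to `1`. -/
theorem exists_subgroup_squareGroup_one : ∃ S : Subgroup (SquareGroup 1), S.index = 16 ∧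
    Nonempty (S ≃* F 5 × F 5) ∧ S ≤ commutator (SquareGroup 1) := by
  let α := involution ![genA, genB⁻¹] (by decide)
  let β := involution ![genA⁻¹, genB] (by decide)
  have hα : ∀ v, α (α v) = v := α.symm_apply_apply
  have hβ : ∀ v, β (β v) = v := β.symm_apply_apply
  have hαa : α genA = genA := by decide
  have hαb : α genB = genB⁻¹ := by decide
  have hβa : β genA = genA⁻¹ := by decide
  have hβb : β genB = genB := by decide
  have hα2 : signAction 0 ^ 2 = 1 := Equiv.ext hα
  have hβ2 : signAction 2 ^ 2 = 1 := Equiv.ext hβ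
  have hαβ : signAction 0 * signAction 2 = signAction 2 * signAction 0 := by
    have : α.toMonoidHom.comp β.toMonoidHom = β.toMonoidHom.comp α.toMonoidHom :=
      FreeGroup.ext_hom _ _ (by decide)
    exact Equiv.ext fun v => DFunLike.congr_fun this v
  have hrel : ∀ i,
      signAction i * (signAction (1 + i))⁻¹ * signAction i * signAction (1 + i) = 1 := by
    intro i
    ext1 v
    fin_cases i
    · change α (genA⁻¹ * (α (genA * v))) = v
      rw [map_mul α genA, hαa, inv_mul_cancel_left, hα]
    · change genA * (β (genA * β v)) = v
      rw [map_mul, hβa, hβ, mul_inv_cancel_left]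
    · change β (genB⁻¹ * (β (genB * v))) = v
      rw [map_mul β genB, hβb, inv_mul_cancel_left, hβ]
    · change genB * (α (genB * α v)) = v
      rw [map_mul, hαb, hα, mul_inv_cancel_left]
  have hK : ∀ k ∈ parities.ker, FreeGroup.lift ![signAction 0, signAction 2 ^ (1 : ℤ)] k = 1 ∧
      FreeGroup.lift ![signAction 2, signAction 0 ^ (1 : ℤ)] k = 1 := by
    intro k hk
    constructor
    · exact map_eq_one_of_mem_ker_parities _ (by simpa using hα2) (by simpa using hβ2)
        (by simpa using hαβ) hk
    · exact map_eq_one_of_mem_ker_parities _ (by simpa using hβ2) (by simpa using hα2)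
        (by simpa using hαβ.symm) hk
  obtain ⟨S, hS, ⟨e⟩, hmem⟩ := exists_subgroup_squareGroup (Or.inl rfl) (ε := 1) (Or.inl rfl)
    signAction (map_one α) rfl (map_one β) rfl hrel hK
  obtain ⟨e₅⟩ := schreierParities.nonempty_ker_mulEquiv
  refine ⟨S, by rw [hS, index_ker_parities], ⟨e.trans (e₅.prodCongr e₅)⟩, fun g hg => ?_⟩
  obtain ⟨u, hu, v, hv, rfl⟩ := hmem g hg
  have hker : ∀ i, ∀ k ∈ parities.ker, pairHom 1 1 i k ∈ commutator (SquareGroup 1) := by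
    intro i k hk
    rw [← Abelianization.ker_of, MonoidHom.mem_ker, ← MonoidHom.comp_apply]
    have hsq : ∀ j, (Abelianization.of (PresentedGroup.of j : SquareGroup 1)) ^ 2 = 1 := by
      intro j
      rw [← map_pow, ← MonoidHom.mem_ker, Abelianization.ker_of]
      exact of_sq_mem_commutator j
    refine map_eq_one_of_mem_ker_parities _ ?_ ?_ (mul_comm _ _) hk
    · simpa [pairHom] using hsq i
    · simpa [pairHom] using hsq (i + 2)
  exact mul_mem (hker 1 u hu) (hker 0 v hv)

/-- The homomorphism onto `(ℤ/2)⁴` that takes the generators to a basis. -/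
def squareParities : SquareGroup 1 →* Multiplicative (ZMod 4 → ZMod 2) :=
  cyclicLift (fun i => Multiplicative.ofAdd (Pi.single i 1)) fun i => by
    rw [lift_map_word]
    revert i
    decide

theorem index_ker_squareParities : squareParities.ker.index = 16 := by
  have hs : Function.Surjective squareParities := by
    intro t
    refine ⟨PresentedGroup.of 0 ^ (t.toAdd 0).val * PresentedGroup.of 1 ^ (t.toAdd 1).val *
      PresentedGroup.of 2 ^ (t.toAdd 2).val * PresentedGroup.of 3 ^ (t.toAdd 3).val, ?_⟩
    simp only [map_mul, map_pow, squareParities, cyclicLift_of]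
    revert t
    decide
  rw [Subgroup.index_ker, MonoidHom.range_eq_top.2 hs]
  simp

/-- The commutator subgroup lies between the subgroup of `exists_subgroup_squareGroup_one` and the
kernel of `squareParities`, both of index `16`. -/
theorem commutator_squareGroup_one : (commutator (SquareGroup 1)).index = 16 ∧
    Nonempty (commutator (SquareGroup 1) ≃* F 5 × F 5) := by
  obtain ⟨S, hS, hS', hle⟩ := exists_subgroup_squareGroup_one
  have h16 : commutator (SquareGroup 1) ≤ squareParities.ker :=
    Abelianization.commutator_subset_ker _
  have h := Subgroup.relIndex_mul_index (hle.trans h16)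
  rw [hS, index_ker_squareParities] at h
  have hSe : S = commutator (SquareGroup 1) :=
    le_antisymm hle (h16.trans (Subgroup.relIndex_eq_one.1 (by omega)))
  rw [← hSe]
  exact ⟨hS, hS'⟩

/-- On pairs of words, `(u, v) ↦ (a⁻¹ v, b⁻¹ u)` for the first generator and
`(u, v) ↦ (b⁻¹ v, a⁻¹ u)` for the second. -/
def twinAction : F 2 →* Equiv.Perm (F 2 × F 2) :=
  FreeGroup.lift ![(Equiv.prodComm _ _).trans (Equiv.mulLeft (genA⁻¹, genB⁻¹)),
    (Equiv.prodComm _ _).trans (Equiv.mulLeft (genB⁻¹, genA⁻¹))]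

theorem twinAction_genA_mul (v : F 2) :
    twinAction (genA * v) 1 = (genA⁻¹ * (twinAction v 1).2, genB⁻¹ * (twinAction v 1).1) := by
  rw [map_mul]
  rfl

theorem twinAction_genB_mul (v : F 2) :
    twinAction (genB * v) 1 = (genB⁻¹ * (twinAction v 1).2, genA⁻¹ * (twinAction v 1).1) := by
  rw [map_mul]
  rfl

theorem twinAction_genA_inv_mul (v : F 2) :
    twinAction (genA⁻¹ * v) 1 = (genB * (twinAction v 1).2, genA * (twinAction v 1).1) := by
  rw [map_mul, map_inv, Equiv.Perm.mul_apply, Equiv.Perm.inv_eq_iff_eq]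
  change _ = (genA⁻¹ * (genA * _), genB⁻¹ * (genB * _))
  rw [inv_mul_cancel_left, inv_mul_cancel_left]

theorem twinAction_genB_inv_mul (v : F 2) :
    twinAction (genB⁻¹ * v) 1 = (genA * (twinAction v 1).2, genB * (twinAction v 1).1) := by
  rw [map_mul, map_inv, Equiv.Perm.mul_apply, Equiv.Perm.inv_eq_iff_eq]
  change _ = (genB⁻¹ * (genB * _), genA⁻¹ * (genA * _))
  rw [inv_mul_cancel_left, inv_mul_cancel_left]

/-- The two components of `v ↦ twinAction v 1` are inverse to each other. -/
theorem twinAction_inverse (v : F 2) : (twinAction (twinAction v 1).1 1).2 = v ∧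
    (twinAction (twinAction v 1).2 1).1 = v := by
  induction v using freeGroup_induction_left with
  | one => simp
  | of_mul j v ih =>
    fin_cases j
    · change (twinAction (twinAction (genA * v) 1).1 1).2 = genA * v ∧
        (twinAction (twinAction (genA * v) 1).2 1).1 = genA * v
      simp only [twinAction_genA_mul, twinAction_genA_inv_mul, twinAction_genB_inv_mul, ih,
        and_self]
    · change (twinAction (twinAction (genB * v) 1).1 1).2 = genB * v ∧
        (twinAction (twinAction (genB * v) 1).2 1).1 = genB * v
      simp only [twinAction_genB_mul, twinAction_genA_inv_mul, twinAction_genB_inv_mul, ih,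
        and_self]
  | of_inv_mul j v ih =>
    fin_cases j
    · change (twinAction (twinAction (genA⁻¹ * v) 1).1 1).2 = genA⁻¹ * v ∧
        (twinAction (twinAction (genA⁻¹ * v) 1).2 1).1 = genA⁻¹ * v
      simp only [twinAction_genA_inv_mul, twinAction_genA_mul, twinAction_genB_mul, ih, and_self]
    · change (twinAction (twinAction (genB⁻¹ * v) 1).1 1).2 = genB⁻¹ * v ∧
        (twinAction (twinAction (genB⁻¹ * v) 1).2 1).1 = genB⁻¹ * v
      simp only [twinAction_genB_inv_mul, twinAction_genA_mul, twinAction_genB_mul, ih, and_self]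

/-- The permutation `R` of the free group on `a, b` with `R 1 = 1`, `R (a v) = a⁻¹ R⁻¹ v` and
`R (b v) = b⁻¹ R⁻¹ v`, whose inverse satisfies `R⁻¹ (a v) = b⁻¹ R v` and `R⁻¹ (b v) = a⁻¹ R v`: the
two are defined together by recursion on words. -/
def quarterTurn : Equiv.Perm (F 2) where
  toFun v := (twinAction v 1).1
  invFun v := (twinAction v 1).2
  left_inv v := (twinAction_inverse v).1
  right_inv v := (twinAction_inverse v).2

theorem quarterTurn_one : quarterTurn 1 = 1 := rfl

theorem quarterTurn_sq_apply (v : F 2) : quarterTurn (quarterTurn v) =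
    quarterTurn.symm (quarterTurn.symm v) := by
  change (twinAction (twinAction v 1).1 1).1 = (twinAction (twinAction v 1).2 1).2
  induction v using freeGroup_induction_left with
  | one => rfl
  | of_mul j v ih =>
    fin_cases j
    · change (twinAction (twinAction (genA * v) 1).1 1).1 =
        (twinAction (twinAction (genA * v) 1).2 1).2
      simp only [twinAction_genA_mul, twinAction_genA_inv_mul, twinAction_genB_inv_mul, ih]
    · change (twinAction (twinAction (genB * v) 1).1 1).1 =
        (twinAction (twinAction (genB * v) 1).2 1).2
      simp only [twinAction_genB_mul, twinAction_genA_inv_mul, twinAction_genB_inv_mul, ih]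
  | of_inv_mul j v ih =>
    fin_cases j
    · change (twinAction (twinAction (genA⁻¹ * v) 1).1 1).1 =
        (twinAction (twinAction (genA⁻¹ * v) 1).2 1).2
      simp only [twinAction_genA_inv_mul, twinAction_genA_mul, twinAction_genB_mul, ih]
    · change (twinAction (twinAction (genB⁻¹ * v) 1).1 1).1 =
        (twinAction (twinAction (genB⁻¹ * v) 1).2 1).2
      simp only [twinAction_genB_inv_mul, twinAction_genA_mul, twinAction_genB_mul, ih]

theorem quarterTurn_pow_four : quarterTurn ^ 4 = 1 := by
  ext1 v
  change quarterTurn (quarterTurn (quarterTurn (quarterTurn v))) = v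
  rw [quarterTurn_sq_apply, Equiv.symm_apply_apply, Equiv.symm_apply_apply]

/-- The action of the generators of `SquareGroup 3` on `F_2`. The generator `x_3` acts as left
multiplication by `b⁻¹`, so that `a` and `b` correspond to `x_1` and `x_3⁻¹`. -/
def turnAction : ZMod 4 → Equiv.Perm (F 2) :=
  (![quarterTurn, Equiv.mulLeft genA, quarterTurn.symm, Equiv.mulLeft genB⁻¹] :
      Fin 4 → Equiv.Perm (F 2))

theorem hasSubgroupIsoOfIndex_squareGroup_three :
    HasSubgroupIsoOfIndex (SquareGroup 3) (F 5 × F 5) 16 := by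
  have hrel : ∀ i,
      turnAction i * (turnAction (1 + i))⁻¹ * turnAction i * turnAction (3 + i) = 1 := by
    intro i
    ext1 v
    fin_cases i
    · change quarterTurn (genA⁻¹ * quarterTurn (genB⁻¹ * v)) = v
      have h : quarterTurn (genB⁻¹ * v) = genA * quarterTurn.symm v :=
        congrArg Prod.fst (twinAction_genB_inv_mul v)
      rw [h, inv_mul_cancel_left, Equiv.apply_symm_apply]
    · change genA * quarterTurn (genA * quarterTurn v) = v
      have h : quarterTurn (genA * quarterTurn v) = genA⁻¹ * quarterTurn.symm (quarterTurn v) :=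
        congrArg Prod.fst (twinAction_genA_mul _)
      rw [h, mul_inv_cancel_left, Equiv.symm_apply_apply]
    · change quarterTurn.symm (genB⁻¹⁻¹ * quarterTurn.symm (genA * v)) = v
      have h : quarterTurn.symm (genA * v) = genB⁻¹ * quarterTurn v :=
        congrArg Prod.snd (twinAction_genA_mul v)
      rw [h, inv_mul_cancel_left, Equiv.symm_apply_apply]
    · change genB⁻¹ * quarterTurn.symm (genB⁻¹ * quarterTurn.symm v) = v
      have h : quarterTurn.symm (genB⁻¹ * quarterTurn.symm v) =
          genB * quarterTurn (quarterTurn.symm v) := congrArg Prod.snd (twinAction_genB_inv_mul _)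
      rw [h, inv_mul_cancel_left, Equiv.apply_symm_apply]
  have h₃ : turnAction 3 ^ (-1 : ℤ) = Equiv.mulLeft genB := by
    rw [zpow_neg_one]
    ext1 v
    rfl
  have hK : ∀ k ∈ (expSum 4).ker,
      FreeGroup.lift ![turnAction 0, turnAction 2 ^ (-1 : ℤ)] k = 1 ∧
        FreeGroup.lift ![turnAction 2, turnAction 0 ^ (-1 : ℤ)] k = 1 := by
    intro k hk
    constructor
    · exact map_eq_one_of_mem_ker_expSum_four _ quarterTurn_pow_four
        (by simp; rfl) hk
    · refine map_eq_one_of_mem_ker_expSum_four _ ?_ (by simp; rfl) hk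
      have : quarterTurn⁻¹ ^ 4 = 1 := by rw [inv_pow, quarterTurn_pow_four, inv_one]
      exact this
  obtain ⟨S, hS, ⟨e⟩, -⟩ := exists_subgroup_squareGroup (Or.inr rfl) (ε := -1) (Or.inr rfl)
    turnAction quarterTurn_one rfl rfl h₃ hrel hK
  obtain ⟨e₄⟩ := schreierFour.nonempty_ker_mulEquiv
  exact ⟨S, by rw [hS, index_ker_expSum], ⟨e.trans (e₄.prodCongr e₄)⟩⟩

/-- For `q = 2` the relators are, up to cyclic permutation and inversion, all given by the same
word. -/
theorem nonempty_mulEquiv_of_two {p s : ZMod 4} (hp : p = 1 ∨ p = 3) (hs : s = 0 ∨ s = 2) :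
    Nonempty (CyclicGroup 4 (word true p 2 s) ≃*
      CyclicGroup 4 (x 0 * x 0 * (x 1)⁻¹ * x 2)) := by
  have hlift : ∀ {H : Type} [Group H] (f : ZMod 4 → H) (i : ZMod 4),
      FreeGroup.lift f (FreeGroup.map (· + i) (x 0 * x 0 * (x 1)⁻¹ * x 2)) =
        f i * f i * (f (1 + i))⁻¹ * f (2 + i) := by
    intro H _ f i
    simp [x]
  have hrel : ∀ i : ZMod 4, (PresentedGroup.of i * PresentedGroup.of i *
      (PresentedGroup.of (1 + i))⁻¹ * PresentedGroup.of (2 + i) :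
        CyclicGroup 4 (x 0 * x 0 * (x 1)⁻¹ * x 2)) = 1 := by
    intro i
    rw [← hlift]
    exact lift_of_map_eq_one _ i
  have h₀ : Nonempty (CyclicGroup 4 (word true 1 2 0) ≃*
      CyclicGroup 4 (x 0 * x 0 * (x 1)⁻¹ * x 2)) := by
    refine nonempty_cyclicGroup_mulEquiv (cyclicLift PresentedGroup.of fun i => ?_)
      (cyclicLift PresentedGroup.of fun i => ?_) (fun i => by simp) (fun i => by simp)
    · rw [lift_map_word, zero_add, cond_true, mul_eq_one_comm, ← mul_assoc, ← mul_assoc]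
      exact hrel i
    · have h := relation true 1 2 0 i
      rw [zero_add, cond_true, mul_eq_one_comm, ← mul_assoc, ← mul_assoc] at h
      rw [hlift, h]
  have h₂ : Nonempty (CyclicGroup 4 (word true 1 2 2) ≃*
      CyclicGroup 4 (x 0 * x 0 * (x 1)⁻¹ * x 2)) := by
    refine nonempty_cyclicGroup_mulEquiv (cyclicLift (fun i => (PresentedGroup.of (2 - i))⁻¹)
      fun i => ?_) (cyclicLift (fun i => (PresentedGroup.of (2 - i))⁻¹) fun i => ?_)
      (fun i => by simp) (fun i => by simp)
    · have h := hrel (-i)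
      rw [lift_map_word, cond_true, inv_inv, ← inv_one, ← h]
      rw [show (2 : ZMod 4) - (1 + i) = 1 + -i by ring, show (2 : ZMod 4) - (2 + i) = -i by ring,
        sub_eq_add_neg]
      group
    · have h := relation true 1 2 2 (-i)
      rw [hlift, inv_inv, show (2 : ZMod 4) - (2 + i) = -i by ring,
        show (2 : ZMod 4) - (1 + i) = 1 + -i by ring, sub_eq_add_neg]
      rw [← inv_one, ← h, cond_true]
      group
  rcases hp with rfl | rfl <;> rcases hs with rfl | rfl
  · exact h₀
  · exact h₂
  · obtain ⟨e⟩ := nonempty_mulEquiv_neg (n := 4) true (p := 3) (q := 2) (r := 0) (p' := 1)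
      (q' := 2) (r' := 0) rfl rfl rfl
    exact h₀.map e.trans
  · obtain ⟨e⟩ := nonempty_mulEquiv_neg (n := 4) true (p := 3) (q := 2) (r := 2) (p' := 1)
      (q' := 2) (r' := 2) rfl rfl rfl
    exact h₂.map e.trans

end Squares

/-! ### Isomorphism classes -/

theorem HasSubgroupIsoOfIndex.of_mulEquiv {G G' H : Type*} [Group G] [Group G'] [Group H] {d : ℕ}
    (e : G ≃* G') (h : HasSubgroupIsoOfIndex G' H d) : HasSubgroupIsoOfIndex G H d := by
  obtain ⟨K, hK, ⟨f⟩⟩ := h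
  exact ⟨K.map e.symm, by rw [Subgroup.index_map_equiv, hK], ⟨(e.symm.subgroupMap K).symm.trans f⟩⟩

theorem commutator_of_mulEquiv {G G' H : Type*} [Group G] [Group G'] [Group H] {d : ℕ}
    (e : G ≃* G') (h : (commutator G').index = d ∧ Nonempty (commutator G' ≃* H)) :
    (commutator G).index = d ∧ Nonempty (commutator G ≃* H) := by
  have hc : commutator G' = (commutator G).map (e : G →* G') := by
    rw [commutator_def, commutator_def, Subgroup.map_commutator,
      Subgroup.map_top_of_surjective _ e.surjective]
  rw [hc, Subgroup.index_map_equiv] at h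
  exact ⟨h.1, h.2.map (e.subgroupMap _).trans⟩

/-- The groups with four generators in the family `x_0 x_p⁻¹ x_q⁻¹ x_{p+q}`: negation of the
subscripts and inversion of the relators leave `p = 1` and `q = 0, 1, 2`. -/
theorem nonempty_mulEquiv_twistedGroup {p : ZMod 4} (hp : p = 1 ∨ p = 3) (q : ZMod 4) :
    Nonempty (CyclicGroup 4 (word false p q (p + q)) ≃* TwistedGroup 0) ∨
      Nonempty (CyclicGroup 4 (word false p q (p + q)) ≃* TwistedGroup 1) ∨
      Nonempty (CyclicGroup 4 (word false p q (p + q)) ≃* TwistedGroup 2) := by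
  have h1 : ∀ q : ZMod 4, Nonempty (CyclicGroup 4 (word false 1 q (1 + q)) ≃* TwistedGroup 0) ∨
      Nonempty (CyclicGroup 4 (word false 1 q (1 + q)) ≃* TwistedGroup 1) ∨
      Nonempty (CyclicGroup 4 (word false 1 q (1 + q)) ≃* TwistedGroup 2) := by
    have hq : ∀ q : ZMod 4, q = 0 ∨ q = 1 ∨ q = 2 ∨ q = 3 := by decide
    intro q
    rcases hq q with rfl | rfl | rfl | rfl
    · exact Or.inl ⟨MulEquiv.refl _⟩
    · exact Or.inr (Or.inl ⟨MulEquiv.refl _⟩)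
    · exact Or.inr (Or.inr ⟨MulEquiv.refl _⟩)
    · obtain ⟨e⟩ := nonempty_mulEquiv_neg_left (n := 4) (p := 1) (q := 3) (r := 1 + 3) (p' := 3)
        (r' := 2) rfl rfl rfl
      obtain ⟨e'⟩ := nonempty_mulEquiv_neg (n := 4) false (p := 3) (q := 3) (r := 2) (p' := 1)
        (q' := 1) (r' := 1 + 1) rfl rfl rfl
      exact Or.inr (Or.inl ⟨e.trans e'⟩)
  rcases hp with rfl | rfl
  · exact h1 q
  · obtain ⟨e⟩ := nonempty_mulEquiv_neg false (p := 3) (q := q) (r := 3 + q) (p' := 1) (q' := -q)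
      (r' := 1 + -q) rfl rfl (by rw [neg_add]; rfl)
    exact (h1 (-q)).imp (·.map e.trans) (Or.imp (·.map e.trans) (·.map e.trans))

end CyclicPresentation

theorem corollary5p6 :
    -- The words `x_0 x_p⁻¹ x_q⁻¹ x_r`.
    (∀ (n : ℕ) [NeZero n] (p q r : ZMod n) (w : FreeGroup (ZMod n)),
      w = x 0 * (x p)⁻¹ * (x q)⁻¹ * x r →
      IsIrreduciblePresentation n w → ¬ IsRedundant (relators n w) →
      ∀ ν : ℕ,
        (IsSpecial 2 4 ν (relators n w) ↔
          n = 4 * ν ∧ ∃ s : ℤ, Int.gcd s ν = 1 ∧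
            ((p = ν ∧ q = -s ∧ r = ν - s) ∨ (p = 3 * ν ∧ q = -s ∧ r = 3 * ν - s))) ∧
        (IsSpecial 2 4 ν (relators n w) →
          HasSubgroupIso (CyclicGroup n w) (F 2 × F 2) ∧
          (∃ f : CyclicGroup n w →* F ν, Function.Surjective f) ∧
          (1 < ν → IsLarge (CyclicGroup n w)) ∧
          (ν = 1 →
            (Nonempty (CyclicGroup n w ≃* CyclicGroup 4 (x 0 * (x 1)⁻¹ * (x 0)⁻¹ * x 1)) ∧
              Nonempty (CyclicGroup 4 (x 0 * (x 1)⁻¹ * (x 0)⁻¹ * x 1) ≃* F 2 × F 2)) ∨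
            (Nonempty (CyclicGroup n w ≃* CyclicGroup 4 (x 0 * (x 1)⁻¹ * (x 1)⁻¹ * x 2)) ∧
              HasSubgroupIsoOfIndex (CyclicGroup 4 (x 0 * (x 1)⁻¹ * (x 1)⁻¹ * x 2))
                (F 5 × F 5) 16) ∨
            (Nonempty (CyclicGroup n w ≃* CyclicGroup 4 (x 0 * (x 1)⁻¹ * (x 2)⁻¹ * x 3)) ∧
              HasSubgroupIsoOfIndex (CyclicGroup 4 (x 0 * (x 1)⁻¹ * (x 2)⁻¹ * x 3))
                (F 3 × F 5) 8)))) ∧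
    -- The words `x_0 x_p⁻¹ x_q x_r`.
    (∀ (n : ℕ) [NeZero n] (p q r : ZMod n) (w : FreeGroup (ZMod n)),
      w = x 0 * (x p)⁻¹ * x q * x r →
      IsIrreduciblePresentation n w →
      (∀ ν : ℕ, IsSpecial 2 4 ν (relators n w) ↔
        ν = 1 ∧ n = 4 ∧
          ((p, q, r) ∈ ({(1, 0, 1), (3, 0, 3)} : Set (ZMod n × ZMod n × ZMod n)) ∨
           (p, q, r) ∈ ({(1, 0, 3), (3, 0, 1)} : Set (ZMod n × ZMod n × ZMod n)) ∨
           (p, q, r) ∈ ({(1, 2, 0), (3, 2, 0), (1, 2, 2), (3, 2, 2)} :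
              Set (ZMod n × ZMod n × ZMod n)))) ∧
      (n = 4 →
        ((p, q, r) ∈ ({(1, 0, 1), (3, 0, 3)} : Set (ZMod n × ZMod n × ZMod n)) →
          Nonempty (CyclicGroup n w ≃* CyclicGroup 4 (x 0 * (x 1)⁻¹ * x 0 * x 1)) ∧
          (commutator (CyclicGroup n w)).index = 16 ∧
          Nonempty (commutator (CyclicGroup n w) ≃* F 5 × F 5)) ∧
        ((p, q, r) ∈ ({(1, 0, 3), (3, 0, 1)} : Set (ZMod n × ZMod n × ZMod n)) →
          Nonempty (CyclicGroup n w ≃* CyclicGroup 4 (x 0 * (x 1)⁻¹ * x 0 * x 3)) ∧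
          HasSubgroupIsoOfIndex (CyclicGroup n w) (F 5 × F 5) 16) ∧
        ((p, q, r) ∈ ({(1, 2, 0), (3, 2, 0), (1, 2, 2), (3, 2, 2)} :
            Set (ZMod n × ZMod n × ZMod n)) →
          Nonempty (CyclicGroup n w ≃* CyclicGroup 4 (x 0 * x 0 * (x 1)⁻¹ * x 2))))) := by
  refine ⟨fun n _ p q r w hw hirr hred ν => ?_, fun n _ p q r w hw hirr => ⟨fun ν => ?_, ?_⟩⟩
  · obtain rfl : w = word false p q r := hw
    refine ⟨isSpecial_word_false_iff hirr hred, fun h => ?_⟩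
    obtain ⟨hn, hp, hc⟩ := (isSpecial_word_iff fun _ => hred).1 h
    obtain rfl : r = p + q := by simpa using hc
    obtain ⟨h4, h2⟩ := (order_four_iff hn).2 hp
    obtain ⟨f, hf⟩ := exists_epimorphism hn hp q
    refine ⟨hasSubgroupIso_prod h4 h2 q, ⟨f, hf⟩, fun hν => isLarge_of_surjective hν hf, ?_⟩
    rintro rfl
    obtain rfl : n = 4 := hn
    have hp' : p = 1 ∨ p = 3 := by simpa using hp
    rcases nonempty_mulEquiv_twistedGroup hp' q with e | e | e
    · exact Or.inl ⟨e, nonempty_mulEquiv_prod⟩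
    · exact Or.inr (Or.inl ⟨e, hasSubgroupIsoOfIndex_one⟩)
    · exact Or.inr (Or.inr ⟨e, hasSubgroupIsoOfIndex_two⟩)
  · obtain rfl : w = word true p q r := hw
    exact isSpecial_word_true_iff hirr
  · rintro rfl
    obtain rfl : w = word true p q r := hw
    simp only [Set.mem_insert_iff, Set.mem_singleton_iff, Prod.mk.injEq]
    refine ⟨?_, ?_, ?_⟩
    · intro h
      have e : Nonempty (CyclicGroup 4 (word true p q r) ≃* SquareGroup 1) := by
        rcases h with ⟨rfl, rfl, rfl⟩ | ⟨rfl, rfl, rfl⟩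
        · exact ⟨MulEquiv.refl _⟩
        · exact nonempty_mulEquiv_neg true rfl rfl rfl
      exact ⟨e, e.elim fun e => commutator_of_mulEquiv e commutator_squareGroup_one⟩
    · intro h
      have e : Nonempty (CyclicGroup 4 (word true p q r) ≃* SquareGroup 3) := by
        rcases h with ⟨rfl, rfl, rfl⟩ | ⟨rfl, rfl, rfl⟩
        · exact ⟨MulEquiv.refl _⟩
        · exact nonempty_mulEquiv_neg true rfl rfl rfl
      exact ⟨e, e.elim fun e => hasSubgroupIsoOfIndex_squareGroup_three.of_mulEquiv e⟩
    · rintro (⟨rfl, rfl, rfl⟩ | ⟨rfl, rfl, rfl⟩ | ⟨rfl, rfl, rfl⟩ | ⟨rfl, rfl, rfl⟩)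
      all_goals exact nonempty_mulEquiv_of_two (by decide) (by decide)
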